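/- Let $r\ge 1$ and let $T=\sum_{i=1}^r\sigma_i\,x_i\otimes y_i\otimes z_i$ be an $n\times n\times n$ real tensor, where $x_i,y_i,z_i\in\mathbb R^n$ are unit vectors and $\sigma_1\ge\dots\ge\sigma_r>0$. Let $c>0$ and $\mu$ be real numbers such that each of the three $n\times r$ matrices with columns $(x_i)$, $(y_i)$, $(z_i)$ has smallest singular value (the $r$-th largest) at least $c$, and the spans $V_x,V_y,V_z$ of $(x_i)$, $(y_i)$, $(z_i)$ are $\mu$-incoherent. Here an $r$-dimensional subspace $V\subset\mathbb R^n$ is called $\mu$-incoherent if the orthogonal projection of every standard basis vector onto $V$ has length at most $\sqrt{\mu r/n}$. For $r$-dimensional $U,V\subset\mathbb R^n$ let $\alpha(U,V)$ be the sine of their (largest) principal angle, that is, the operator norm of the orthogonal projection onto $V^\perp$ restricted to $U$. Kronecker Alternating Minimization. Let $p'\in[0,1]$, let $k$ be the number of iterations, and let $S_1,\dots,S_k$ be independent random sets of observed entries, each containing every position of the tensor independently with probability $p'$. Start from given $r$-dimensional subspaces $V_x^0,V_y^0,V_z^0$ of $\mathbb R^n$. For $t=0,\dots,k-1$, let $B_t$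 be an $r^2\times n^2$ matrix whose rows are an orthonormal basis of $V_y^t\otimes V_z^t$, let $H_{t+1}$ be a minimizer over $H\in\mathbb R^{n\times r^2}$ of the sum of the squares of the entries of $U_x(T)-HB_t$ at the positions observed in $S_{t+1}$, where $U_x(T)$ is the $n\times n^2$ unfolding of $T$ whose rows correspond to the first mode, and let $V_x^{t+1}$ be the span of the top $r$ left singular vectors of $H_{t+1}$. In the same way, with the same sample $S_{t+1}$ and the unfoldings along the other two modes, compute $V_y^{t+1}$ from $V_x^t,V_z^t$, and $V_z^{t+1}$ from $V_x^t,V_y^t$. If minimizers or singular vectors are not unique, any choice may be made, as long as the estimates at time $t$ are a function of $S_1,\dots,S_t$ only. Put $$\mu'=\Big(\frac{2\mu r}{c^2}\cdot\frac{\sigma_1^2}{\sigma_r^2}\Big)^{10},\qquad L=\log\frac{n\sigma_1}{c\sigma_r}\ (\ge 0),$$ and suppose that $$p'\ \ge\ \frac{L^2}{n^2}\Big(\frac{10r\mu'}{c}\cdot\frac{\sigma_1}{\sigma_r}\Big)^{10}.$$ **Theorem.** Fix $0\le t<k$, and let $A$ be an event of positive probability that is determined by $S_1,\dots,S_t$ and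 on which $V_x^t,V_y^t,V_z^t$ are $\mu'$-incoherent and $$\max\big(\alpha(V_x,V_x^t),\alpha(V_y,V_y^t),\alpha(V_z,V_z^t)\big)\le 0.1 .$$ Then, conditionally on $A$, with probability at least $1-\frac{1}{10^4L}$ (at least $1$ in the degenerate case $L=0$, that is, $n=r=c=1$), both of the following hold: 1. $\max\big(\alpha(V_x,V_x^{t+1}),\alpha(V_y,V_y^{t+1}),\alpha(V_z,V_z^{t+1})\big)\le 0.2\,\max\big(\alpha(V_x,V_x^t),\alpha(V_y,V_y^t),\alpha(V_z,V_z^t)\big)$; 2. $V_x^{t+1},V_y^{t+1},V_z^{t+1}$ are $\mu'$-incoherent. -/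

import Mathlib

namespace KroneckerCompletion

noncomputable section

open scoped BigOperators

/-- `α(U, V) = ‖V_⊥ᵀ U‖_op`, the sine of the principal angle: the operator norm of the orthogonal
projection onto `Vᗮ`, restricted to `U`. -/
def sinAngle {n : ℕ} (U V : Submodule ℝ (EuclideanSpace ℝ (Fin n))) : ℝ :=
  ‖Vᗮ.orthogonalProjectionOnto ∘L U.subtypeL‖

/-- `V` is `μ`-incoherent: every standard basis vector projects onto `V` with length at most
`√(μ · dim V / n)`. -/
def IsIncoherent {n : ℕ} (μ : ℝ) (V : Submodule ℝ (EuclideanSpace ℝ (Fin n))) : Prop :=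
  ∀ i : Fin n, ‖V.orthogonalProjectionOnto (EuclideanSpace.single i (1 : ℝ))‖ ≤
    √(μ * (Module.finrank ℝ V : ℝ) / (n : ℝ))

/-- The smallest singular value of the `n × r` matrix with columns `x 0, …, x (r - 1)`, for `0 < r`
(Mathlib's singular values are decreasing, with multiplicity, and indexed from `0`). -/
def smallestSingularValue {n r : ℕ} (x : Fin r → EuclideanSpace ℝ (Fin n)) : ℝ :=
  LinearMap.singularValues
    (Matrix.toEuclideanLin (Matrix.of fun (j : Fin n) (i : Fin r) => x i j)) (r - 1)

/-- The positions of the entries of an `n × n × n` tensor. -/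
abbrev Entry (n : ℕ) : Type := Fin n × Fin n × Fin n

/-- The tensor `∑ i, σ i • (x i ⊗ y i ⊗ z i)`. -/
def cpTensor {n r : ℕ} (σ : Fin r → ℝ) (x y z : Fin r → EuclideanSpace ℝ (Fin n)) :
    Entry n → ℝ :=
  fun e => ∑ i, σ i * (x i e.1 * y i e.2.1 * z i e.2.2)

/-- A triple of subspaces of `ℝⁿ`, one for each mode of the tensor. -/
@[ext] structure SubspaceTriple (n : ℕ) where
  x : Submodule ℝ (EuclideanSpace ℝ (Fin n))
  y : Submodule ℝ (EuclideanSpace ℝ (Fin n))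
  z : Submodule ℝ (EuclideanSpace ℝ (Fin n))

/-- The spans of the three families of factors. -/
def factorSpaces {n r : ℕ} (x y z : Fin r → EuclideanSpace ℝ (Fin n)) : SubspaceTriple n where
  x := Submodule.span ℝ (Set.range x)
  y := Submodule.span ℝ (Set.range y)
  z := Submodule.span ℝ (Set.range z)

/-- All three subspaces are `μ`-incoherent. -/
def SubspaceTriple.Incoherent {n : ℕ} (μ : ℝ) (W : SubspaceTriple n) : Prop :=
  IsIncoherent μ W.x ∧ IsIncoherent μ W.y ∧ IsIncoherent μ W.z

/-- All three subspaces have dimension `r`. -/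
def SubspaceTriple.HasDim {n : ℕ} (r : ℕ) (W : SubspaceTriple n) : Prop :=
  Module.finrank ℝ W.x = r ∧ Module.finrank ℝ W.y = r ∧ Module.finrank ℝ W.z = r

/-- The maximum over the three modes of the sine of the principal angle. -/
def maxSinAngle {n : ℕ} (U W : SubspaceTriple n) : ℝ :=
  max (max (sinAngle U.x W.x) (sinAngle U.y W.y)) (sinAngle U.z W.z)

/-- The vector `v ⊗ w` of `ℝ^{n²}`. -/
def outer {n : ℕ} (v w : EuclideanSpace ℝ (Fin n)) : EuclideanSpace ℝ (Fin n × Fin n) :=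
  WithLp.toLp 2 fun q => v q.1 * w q.2

/-- The subspace `V ⊗ W` of `ℝ^{n²}`. -/
def tensorSpace {n : ℕ} (V W : Submodule ℝ (EuclideanSpace ℝ (Fin n))) :
    Submodule ℝ (EuclideanSpace ℝ (Fin n × Fin n)) :=
  Submodule.span ℝ (Set.image2 outer V W)

/-- The rows of `B` are an orthonormal basis of `V ⊗ W`. -/
def IsTensorBasis {n r : ℕ} (V W : Submodule ℝ (EuclideanSpace ℝ (Fin n)))
    (B : Matrix (Fin (r ^ 2)) (Fin n × Fin n) ℝ) : Prop :=
  Orthonormal ℝ (fun i => (WithLp.toLp 2 (B i) : EuclideanSpace ℝ (Fin n × Fin n))) ∧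
    Submodule.span ℝ
      (Set.range fun i => (WithLp.toLp 2 (B i) : EuclideanSpace ℝ (Fin n × Fin n))) =
        tensorSpace V W

/-- `‖(U - H B)|_Ω‖₂²`, the sum of squared errors over the observed positions `Ω` of the unfolding;
it depends on the entries of `U` in `Ω` only. -/
def observedLoss {n m : ℕ} (U : Matrix (Fin n) (Fin n × Fin n) ℝ)
    (Ω : Set (Fin n × (Fin n × Fin n))) (B : Matrix (Fin m) (Fin n × Fin n) ℝ)
    (H : Matrix (Fin n) (Fin m) ℝ) : ℝ :=
  ∑ q, Ω.indicator (fun q => (U q.1 q.2 - (H * B) q.1 q.2) ^ 2) q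

/-- `V` is spanned by top `r` left singular vectors of `H`: for an orthonormal basis
`u 0, u 1, …` of left singular vectors, i.e. eigenvectors of `H Hᵀ`, whose singular values
`s 0 ≥ s 1 ≥ … ≥ 0` are decreasing, `V` is the span of the first `r` of them. -/
def IsTopLeftSingularSpace {n m : ℕ} (r : ℕ) (H : Matrix (Fin n) (Fin m) ℝ)
    (V : Submodule ℝ (EuclideanSpace ℝ (Fin n))) : Prop :=
  r ≤ n ∧ ∃ (u : OrthonormalBasis (Fin n) ℝ (EuclideanSpace ℝ (Fin n))) (s : Fin n → ℝ),
    Antitone s ∧ (∀ i, 0 ≤ s i) ∧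
    (∀ i, Matrix.toEuclideanLin (H * H.transpose) (u i) = (s i ^ 2) • u i) ∧
    V = Submodule.span ℝ (u '' {i | (i : ℕ) < r})

/-- The update of one mode. Here `entry j (a, b)` is the tensor position that the unfolding puts
into row `j` and column `(a, b)`; `V` and `W` are the current estimates for the two modes that
make up the columns; `S` is the set of observed entries; `V'` is the new estimate. -/
def IsModeUpdate {n : ℕ} (r : ℕ) (T : Entry n → ℝ) (S : Set (Entry n))
    (entry : Fin n → Fin n × Fin n → Entry n)
    (V W V' : Submodule ℝ (EuclideanSpace ℝ (Fin n))) : Prop :=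
  ∃ (B : Matrix (Fin (r ^ 2)) (Fin n × Fin n) ℝ) (H : Matrix (Fin n) (Fin (r ^ 2)) ℝ),
    IsTensorBasis V W B ∧
    (∀ H' : Matrix (Fin n) (Fin (r ^ 2)) ℝ,
      observedLoss (Matrix.of fun j q => T (entry j q)) {q | entry q.1 q.2 ∈ S} B H ≤
        observedLoss (Matrix.of fun j q => T (entry j q)) {q | entry q.1 q.2 ∈ S} B H') ∧
    IsTopLeftSingularSpace r H V'

/-- `W'` is a possible result of one iteration of Kronecker alternating minimization that starts
from `W` and uses the observed entries `S` of `T` (minimizers, bases and singular vectors need not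
be unique). All three modes are updated from the old estimates, with the same sample. -/
def IsIteration {n : ℕ} (r : ℕ) (T : Entry n → ℝ) (S : Set (Entry n))
    (W W' : SubspaceTriple n) : Prop :=
  IsModeUpdate r T S (fun j q => (j, q.1, q.2)) W.y W.z W'.x ∧
  IsModeUpdate r T S (fun j q => (q.1, j, q.2)) W.x W.z W'.y ∧
  IsModeUpdate r T S (fun j q => (q.1, q.2, j)) W.x W.y W'.z

/-- The law of `k` independent samples, in each of which every entry is observed independently
with probability `p`. -/
def sampleLaw (n k : ℕ) (p : unitInterval) :
    MeasureTheory.Measure (Fin k → Set (Entry n)) :=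
  MeasureTheory.Measure.pi fun _ => ProbabilityTheory.setBernoulli Set.univ p

/-- `W ω t` is the estimate after `t` iterations of Kronecker alternating minimization on the
samples `ω 0, …, ω (k - 1)`, started from `W₀`. The iteration from `t` to `t + 1` uses the
sample `ω t`, so that `W ω t` is determined by the first `t` samples; ties in the choice of
minimizers and singular vectors are broken in any way that respects this. -/
structure IsRun {n : ℕ} (r k : ℕ) (T : Entry n → ℝ) (W₀ : SubspaceTriple n)
    (W : (Fin k → Set (Entry n)) → ℕ → SubspaceTriple n) : Prop where
  init : ∀ ω, W ω 0 = W₀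
  iteration : ∀ ω (t : Fin k), IsIteration r T (ω t) (W ω t) (W ω (t + 1))
  nonanticipating : ∀ ω ω' (t : ℕ), t ≤ k → (∀ s : Fin k, (s : ℕ) < t → ω s = ω' s) →
    W ω t = W ω' t

/-- The event `A` is determined by the first `t` samples. -/
def DependsOnFirst {n k : ℕ} (t : ℕ) (A : Set (Fin k → Set (Entry n))) : Prop :=
  ∀ ω ω', (∀ s : Fin k, (s : ℕ) < t → ω s = ω' s) → (ω ∈ A ↔ ω' ∈ A)

end

end KroneckerCompletion

/-! Consider the first mode; the others are the same after permuting the roles. Let K = V ⊗ W be the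
space spanned by the current estimates of the other two modes, P the orthogonal projection onto K,
and U_j row j of the unfolding. Least squares splits by rows: row j of H B is the point w_j of K
that best fits U_j on the observed positions. Under full observation w_j would be P U_j. The matrix
Ψ with rows P U_j kills the complement of V_x and is at least c²σᵣ/2 on V_x, because P moves every
combination of the y_i ⊗ z_i by at most a fraction 2α ≤ 1/5 of its norm
(`norm_sub_starProjection_tensorSpace_le`). So full observation would recover V_x at once, and the
only error comes from sampling.

The normal equations bound (p/2)‖w_j − P U_j‖ by the norm of P applied to the observed part of the
residual e_j = U_j − P U_j (`norm_sub_starProjection_le_of_normal`). As e_j is orthogonal to K, that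
vector has mean zero, and incoherence of K makes its second moment at most pγ²‖e_j‖² with γ = μ'r/n.
Since ‖e_j‖ ≤ 2α‖U_j‖, the noise is itself proportional to α. Markov's inequality and a Wedin type
bound (`norm_starProjection_orthogonal_topSpace_le`) then give the new angle 0.2α. The lower bound
p/2 for the sampled Gram matrix on K comes from a Bernstein bound for each of its entries.

Incoherence is not inherited from the old estimates. The projection of the j-th basis vector onto
the new space is at most ‖w_j‖ divided by the r-th singular value, and ‖w_j‖ is controlled by the
observed entries of U_j, which are small because the true factors are incoherent. The resulting
bound does not contain μ', so incoherence does not degrade over time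
(`IsModeUpdate.sinAngle_le_and_isIncoherent`).

Finally, the estimate at time t and the event A do not depend on the sample used next, so the
one-step bound can be integrated over that sample alone (`one_sub_le_cond_real`). The bad event for
this sample concerns all possible outcomes of the iteration, which makes the choice among ties
irrelevant. -/

namespace KroneckerCompletion

open MeasureTheory ProbabilityTheory

/-! ### Bernoulli samples: moments and concentration -/

section Bernoulli

variable {ι κ : Type*} [Fintype ι] [Fintype κ]

/-- The indicator of the event that `i` is observed. -/
noncomputable def obs (s : Set ι) (i : ι) : ℝ := s.indicator (fun _ => (1 : ℝ)) i

omit [Fintype ι] in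
theorem obs_eq_ite (s : Set ι) (i : ι) [Decidable (i ∈ s)] : obs s i = if i ∈ s then 1 else 0 := by
  unfold obs
  by_cases h : i ∈ s <;> simp [h]

-- Expanding the product on the right chooses `f` or `g` at each index, that is, a subset.
open Classical in
theorem sum_set_prod_ite (f g : ι → ℝ) :
    ∑ s : Set ι, ∏ i, (if i ∈ s then f i else g i) = ∏ i, (f i + g i) := by
  rw [Finset.prod_add, Finset.powerset_univ,
    ← (Fintype.finsetEquivSet (α := ι)).sum_comp]
  refine Finset.sum_congr rfl fun t _ => ?_
  rw [Finset.prod_ite]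
  congr 1
  · refine Finset.prod_congr ?_ fun _ _ => rfl
    ext i; simp
  · refine Finset.prod_congr ?_ fun _ _ => rfl
    ext i; simp

open Classical in
theorem setBernoulli_univ_real_singleton (p : unitInterval) (s : Set ι) :
    (setBernoulli (Set.univ : Set ι) p).real {s} = ∏ i, (if i ∈ s then (p : ℝ) else 1 - p) := by
  rw [setBernoulli_real_singleton p (Set.subset_univ s) Set.finite_univ, Finset.prod_ite]
  simp only [Finset.prod_const]
  congr 2
  · rw [← Set.ncard_coe_finset]; congr 1; ext; simp
  · rw [← Set.ncard_coe_finset]; congr 1; ext; simp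

theorem integral_setBernoulli (p : unitInterval) (F : Set ι → ℝ) :
    ∫ s, F s ∂(setBernoulli (Set.univ : Set ι) p) =
      ∑ s, (setBernoulli (Set.univ : Set ι) p).real {s} * F s := by
  rw [integral_fintype Integrable.of_finite]
  rfl

-- This product formula is the form in which independence of the entries is used: the variance and
-- the exponential moment below are both read off from it.
open Classical in
theorem integral_prod_ite (p : unitInterval) (f g : ι → ℝ) :
    ∫ s, ∏ i, (if i ∈ s then f i else g i) ∂(setBernoulli (Set.univ : Set ι) p) =
      ∏ i, (p * f i + (1 - p) * g i) := by
  rw [integral_setBernoulli, ← sum_set_prod_ite]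
  refine Finset.sum_congr rfl fun s _ => ?_
  rw [setBernoulli_univ_real_singleton, ← Finset.prod_mul_distrib]
  refine Finset.prod_congr rfl fun i _ => ?_
  split_ifs <;> rfl

theorem integral_obs_sub_mul (p : unitInterval) {i j : ι} (hij : i ≠ j) :
    ∫ s, (obs s i - p) * (obs s j - p) ∂(setBernoulli (Set.univ : Set ι) p) = 0 := by
  classical
  have h := integral_prod_ite p (fun k => if k = i ∨ k = j then 1 - (p : ℝ) else 1)
    (fun k => if k = i ∨ k = j then - (p : ℝ) else 1)
  -- The factor at `i` is p(1 − p) + (1 − p)(−p) = 0.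
  rw [Finset.prod_eq_zero (Finset.mem_univ i) (by simp; ring)] at h
  rw [← h]
  congr 1
  ext s
  rw [← Finset.prod_subset (Finset.subset_univ {i, j}), Finset.prod_pair hij]
  · simp only [obs_eq_ite]
    split_ifs <;> simp_all
  · intro k _ hk
    simp only [Finset.mem_insert, Finset.mem_singleton] at hk
    simp [hk]

theorem integral_obs_sub_sq (p : unitInterval) (i : ι) :
    ∫ s, (obs s i - p) * (obs s i - p) ∂(setBernoulli (Set.univ : Set ι) p) = p * (1 - p) := by
  classical
  have h := integral_prod_ite p (fun k => if k = i then (1 - (p : ℝ)) ^ 2 else 1)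
    (fun k => if k = i then (p : ℝ) ^ 2 else 1)
  rw [Finset.prod_eq_single i (by intro k _ hk; simp [hk]) (by simp)] at h
  simp only [if_true] at h
  rw [show (p : ℝ) * (1 - p) = p * (1 - (p : ℝ)) ^ 2 + (1 - p) * (p : ℝ) ^ 2 by ring, ← h]
  congr 1
  ext s
  rw [Finset.prod_eq_single i (by intro k _ hk; simp [hk]) (by simp)]
  simp only [obs_eq_ite]
  split_ifs <;> ring

/-- The variance of a linear statistic of the sample. -/
theorem integral_sum_obs_sub_sq (p : unitInterval) {e : κ → ι} (he : e.Injective) (a : κ → ℝ) :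
    ∫ s, (∑ k, (obs s (e k) - p) * a k) ^ 2 ∂(setBernoulli (Set.univ : Set ι) p) =
      p * (1 - p) * ∑ k, a k ^ 2 := by
  classical
  simp_rw [sq, Finset.sum_mul_sum]
  rw [integral_finsetSum _ fun _ _ => Integrable.of_finite, Finset.mul_sum]
  refine Finset.sum_congr rfl fun k _ => ?_
  rw [integral_finsetSum _ fun _ _ => Integrable.of_finite]
  rw [Finset.sum_eq_single k]
  · have : ∀ s : Set ι, (obs s (e k) - p) * a k * ((obs s (e k) - p) * a k) =
        (obs s (e k) - p) * (obs s (e k) - p) * (a k * a k) := fun s => by ring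
    simp_rw [this]
    rw [integral_mul_const, integral_obs_sub_sq]
  · intro l _ hl
    have : ∀ s : Set ι, (obs s (e k) - p) * a k * ((obs s (e l) - p) * a l) =
        (obs s (e k) - p) * (obs s (e l) - p) * (a k * a l) := fun s => by ring
    simp_rw [this]
    rw [integral_mul_const, integral_obs_sub_mul p (fun h => hl (he h).symm), zero_mul]
  · simp

/-- Factor out exp(−ps); then use exp s ≤ 1 + s + s² for |s| ≤ 1 and 1 + u ≤ exp u. -/
theorem bernoulli_mgf_le {p s : ℝ} (hp : 0 ≤ p) (hs : |s| ≤ 1) :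
    p * Real.exp ((1 - p) * s) + (1 - p) * Real.exp (-p * s) ≤ Real.exp (p * s ^ 2) := by
  have h1 := (abs_le.1 (Real.abs_exp_sub_one_sub_id_le hs)).2
  have h2 : p * Real.exp ((1 - p) * s) + (1 - p) * Real.exp (-p * s) =
      Real.exp (-p * s) * (1 + p * (Real.exp s - 1)) := by
    rw [show (1 - p) * s = -p * s + s by ring, Real.exp_add]; ring
  rw [h2]
  have h3 : 1 + p * (Real.exp s - 1) ≤ Real.exp (p * (s + s ^ 2)) := by
    refine le_trans ?_ (Real.add_one_le_exp _)
    nlinarith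
  calc _ ≤ Real.exp (-p * s) * Real.exp (p * (s + s ^ 2)) := by gcongr
    _ = _ := by rw [← Real.exp_add]; congr 1; ring

theorem integral_exp_sum_obs_le (p : unitInterval) (a : ι → ℝ) (ha : ∀ k, |a k| ≤ 1) :
    ∫ s, Real.exp (∑ k, (obs s k - p) * a k) ∂(setBernoulli (Set.univ : Set ι) p) ≤
      Real.exp (p * ∑ k, a k ^ 2) := by
  classical
  have : ∀ s : Set ι, Real.exp (∑ k, (obs s k - p) * a k) =
      ∏ k, (if k ∈ s then Real.exp ((1 - p) * a k) else Real.exp (-p * a k)) := by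
    intro s
    rw [Real.exp_sum]
    refine Finset.prod_congr rfl fun k _ => ?_
    rw [obs_eq_ite]
    split_ifs <;> simp
  simp_rw [this]
  rw [integral_prod_ite, Finset.mul_sum, Real.exp_sum]
  have hp0 := p.2.1
  have hp1 := p.2.2
  refine Finset.prod_le_prod (fun k _ => ?_) fun k _ => bernoulli_mgf_le p.2.1 (ha k)
  have : 0 ≤ 1 - (p : ℝ) := by linarith
  positivity

/-- A Bernstein type bound for a linear statistic of the sample. -/
theorem measureReal_sum_obs_ge_le (p : unitInterval) {e : κ → ι} (he : e.Injective) (a : κ → ℝ)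
    {β D ε : ℝ} (hβ : 0 < β) (ha : ∀ k, |a k| ≤ β) (hD : ∑ k, a k ^ 2 ≤ β * D)
    (hε0 : 0 ≤ ε) (hε1 : ε ≤ 1) :
    (setBernoulli (Set.univ : Set ι) p).real
      {s | 2 * ε * p * D ≤ ∑ k, (obs s (e k) - p) * a k} ≤ Real.exp (-(ε ^ 2 * p * D / β)) := by
  classical
  have hp0 := p.2.1
  -- The Chernoff multiplier λ = ε/β minimises pλ²βD − 2λεpD and keeps the weights at most 1 in
  -- absolute value. Entries outside the range of `e` get weight 0.
  set b : ι → ℝ := fun i => ε / β * Function.extend e a 0 i with hb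
  have hbe : ∀ k, b (e k) = ε / β * a k := fun k => by simp [hb, he.extend_apply]
  have hb0 : ∀ i, i ∉ Set.range e → b i = 0 := fun i hi => by
    simp only [hb]
    rw [Function.extend_apply' _ _ _ (by simpa using hi)]; simp
  have hb1 : ∀ i, |b i| ≤ 1 := by
    intro i
    by_cases hi : i ∈ Set.range e
    · obtain ⟨k, rfl⟩ := hi
      rw [hbe, abs_mul, abs_of_nonneg (by positivity), div_mul_eq_mul_div, div_le_one hβ]
      have := ha k
      nlinarith [abs_nonneg (a k)]
    · simp [hb0 i hi]
  have hsum : ∀ s : Set ι, ∑ k, (obs s k - p) * b k =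
      ε / β * ∑ k, (obs s (e k) - p) * a k := by
    intro s
    rw [Finset.mul_sum]
    symm
    refine Fintype.sum_of_injective e he _ _ (fun i hi => by simp [hb0 i hi]) fun k => ?_
    rw [hbe]; ring
  have hsq : ∑ k, b k ^ 2 = (ε / β) ^ 2 * ∑ k, a k ^ 2 := by
    rw [Finset.mul_sum]
    symm
    refine Fintype.sum_of_injective e he _ _ (fun i hi => by simp [hb0 i hi]) fun k => ?_
    rw [hbe]; ring
  have h1 := integral_exp_sum_obs_le p b hb1
  have h2 := mul_meas_ge_le_integral_of_nonneg (μ := setBernoulli (Set.univ : Set ι) p)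
    (f := fun s => Real.exp (∑ k, (obs s k - p) * b k))
    (Filter.Eventually.of_forall fun s => (Real.exp_pos _).le) Integrable.of_finite
    (Real.exp (ε / β * (2 * ε * p * D)))
  have h3 : (setBernoulli (Set.univ : Set ι) p).real
      {s | 2 * ε * p * D ≤ ∑ k, (obs s (e k) - p) * a k} ≤
      (setBernoulli (Set.univ : Set ι) p).real
      {s | Real.exp (ε / β * (2 * ε * p * D)) ≤ Real.exp (∑ k, (obs s k - p) * b k)} := by
    refine measureReal_mono fun s hs => ?_
    simp only [Set.mem_ofPred_eq] at hs ⊢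
    rw [hsum]
    gcongr
  refine h3.trans ?_
  have h4 := h2.trans h1
  rw [mul_comm, ← le_div_iff₀ (Real.exp_pos _), ← Real.exp_sub] at h4
  refine h4.trans (Real.exp_le_exp.2 ?_)
  rw [hsq]
  have h5 : (p : ℝ) * ((ε / β) ^ 2 * ∑ k, a k ^ 2) ≤ p * ((ε / β) ^ 2 * (β * D)) := by gcongr
  have h6 : (p : ℝ) * ((ε / β) ^ 2 * (β * D)) - ε / β * (2 * ε * p * D) =
    -(ε ^ 2 * p * D / β) := by field_simp; ring
  linarith

/-- The two-sided Bernstein type bound. -/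
theorem measureReal_abs_sum_obs_ge_le (p : unitInterval) {e : κ → ι} (he : e.Injective) (a : κ → ℝ)
    {β D ε : ℝ} (hβ : 0 < β) (ha : ∀ k, |a k| ≤ β) (hD : ∑ k, a k ^ 2 ≤ β * D)
    (hε0 : 0 ≤ ε) (hε1 : ε ≤ 1) :
    (setBernoulli (Set.univ : Set ι) p).real
      {s | 2 * ε * p * D ≤ |∑ k, (obs s (e k) - p) * a k|} ≤
        2 * Real.exp (-(ε ^ 2 * p * D / β)) := by
  have h1 := measureReal_sum_obs_ge_le p he a hβ ha hD hε0 hε1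
  have h2 := measureReal_sum_obs_ge_le p he (fun k => -a k) hβ (by simpa using ha)
    (by simpa using hD) hε0 hε1
  have h3 : {s : Set ι | 2 * ε * p * D ≤ |∑ k, (obs s (e k) - p) * a k|} ⊆
      {s | 2 * ε * p * D ≤ ∑ k, (obs s (e k) - p) * a k} ∪
      {s | 2 * ε * p * D ≤ ∑ k, (obs s (e k) - p) * -a k} := by
    intro s hs
    simp only [Set.mem_union, Set.mem_ofPred_eq, mul_neg, Finset.sum_neg_distrib] at hs ⊢
    exact le_abs.1 hs
  have h4 := (measureReal_mono h3).trans (measureReal_union_le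
    (μ := setBernoulli (Set.univ : Set ι) p) _ _)
  linarith

end Bernoulli

/-- Markov's inequality, in a form that allows the expectation to vanish. -/
theorem measureReal_mul_lt_le_inv {Ω : Type*} [MeasurableSpace Ω] {P : Measure Ω}
    [IsFiniteMeasure P] {f : Ω → ℝ} (hf : ∀ ω, 0 ≤ f ω) (hfi : Integrable f P) {a K : ℝ}
    (ha : 0 ≤ a) (hfa : ∫ ω, f ω ∂P ≤ a) (hK : 0 < K) : P.real {ω | K * a < f ω} ≤ K⁻¹ := by
  rcases ha.eq_or_lt with rfl | ha
  · have h0 : ∫ ω, f ω ∂P = 0 := le_antisymm hfa (integral_nonneg hf)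
    rw [integral_eq_zero_iff_of_nonneg hf hfi] at h0
    have : P {ω | K * 0 < f ω} = 0 := by
      refine measure_mono_null (fun ω hω => ?_) h0
      simp only [mul_zero, Set.mem_ofPred_eq] at hω
      simpa using hω.ne'
    rw [measureReal_def, this]
    simpa using hK.le
  · have h1 := mul_meas_ge_le_integral_of_nonneg (Filter.Eventually.of_forall hf) hfi (K * a)
    have h2 : P.real {ω | K * a < f ω} ≤ P.real {ω | K * a ≤ f ω} :=
      measureReal_mono fun ω hω => by
        simp only [Set.mem_ofPred_eq] at hω ⊢; exact hω.le
    have h3 : K * a * P.real {ω | K * a < f ω} ≤ a :=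
      le_trans (by gcongr) (h1.trans hfa)
    rw [← one_div, le_div_iff₀ hK]
    nlinarith

/-! ### Sines of principal angles -/

section Angles

variable {n : ℕ}

theorem norm_starProjection_orthogonal_le_sinAngle (U V : Submodule ℝ (EuclideanSpace ℝ (Fin n)))
    {v : EuclideanSpace ℝ (Fin n)} (hv : v ∈ U) :
    ‖Vᗮ.starProjection v‖ ≤ sinAngle U V * ‖v‖ := by
  have := (Vᗮ.orthogonalProjectionOnto ∘L U.subtypeL).le_opNorm ⟨v, hv⟩
  simpa [sinAngle] using this

theorem sinAngle_le {U V : Submodule ℝ (EuclideanSpace ℝ (Fin n))} {M : ℝ} (hM : 0 ≤ M)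
    (h : ∀ v ∈ U, ‖Vᗮ.starProjection v‖ ≤ M * ‖v‖) : sinAngle U V ≤ M := by
  refine ContinuousLinearMap.opNorm_le_bound _ hM fun v => ?_
  simpa using h v v.2

theorem sinAngle_nonneg (U V : Submodule ℝ (EuclideanSpace ℝ (Fin n))) : 0 ≤ sinAngle U V := by
  unfold sinAngle
  positivity

end Angles

/-! ### Perturbation of singular values and singular subspaces -/

section Perturbation

variable {n r : ℕ} {F : Type*} [NormedAddCommGroup F] [InnerProductSpace ℝ F]
  {Φ Ψ : EuclideanSpace ℝ (Fin n) →ₗ[ℝ] F}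
  {u : OrthonormalBasis (Fin n) ℝ (EuclideanSpace ℝ (Fin n))} {s : Fin n → ℝ}

theorem sq_norm_eq_sum_inner_sq (u : OrthonormalBasis (Fin n) ℝ (EuclideanSpace ℝ (Fin n)))
    (a : EuclideanSpace ℝ (Fin n)) : ‖a‖ ^ 2 = ∑ i, inner ℝ (u i) a ^ 2 := by
  rw [← u.sum_sq_norm_inner_right a]
  simp

/-- The identity `hΦ` is all that is kept of the singular value decomposition of Φ: the estimates of
this part need only norms of images, never the right singular vectors. -/
theorem norm_apply_le_of_inner_eq_zero
    (hs : Antitone s) (hs0 : ∀ i, 0 ≤ s i)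
    (hΦ : ∀ a, ‖Φ a‖ ^ 2 = ∑ i, s i ^ 2 * inner ℝ (u i) a ^ 2) (m : Fin n)
    {a : EuclideanSpace ℝ (Fin n)} (ha : ∀ i < m, inner ℝ (u i) a = 0) :
    ‖Φ a‖ ≤ s m * ‖a‖ := by
  refine le_of_sq_le_sq ?_ (mul_nonneg (hs0 m) (norm_nonneg _))
  rw [hΦ, mul_pow, sq_norm_eq_sum_inner_sq u a, Finset.mul_sum]
  refine Finset.sum_le_sum fun i _ => ?_
  rcases lt_or_ge i m with h | h
  · simp [ha i h]
  · have := hs h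
    have := hs0 i
    gcongr

theorem le_norm_apply_of_inner_eq_zero
    (hs : Antitone s) (hs0 : ∀ i, 0 ≤ s i)
    (hΦ : ∀ a, ‖Φ a‖ ^ 2 = ∑ i, s i ^ 2 * inner ℝ (u i) a ^ 2) (m : Fin n)
    {a : EuclideanSpace ℝ (Fin n)} (ha : ∀ i, m < i → inner ℝ (u i) a = 0) :
    s m * ‖a‖ ≤ ‖Φ a‖ := by
  refine le_of_sq_le_sq ?_ (norm_nonneg _)
  rw [hΦ, mul_pow, sq_norm_eq_sum_inner_sq u a, Finset.mul_sum]
  refine Finset.sum_le_sum fun i _ => ?_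
  rcases lt_or_ge m i with h | h
  · simp [ha i h]
  · have := hs h
    have := hs0 m
    gcongr

/-- Weyl's inequality for the singular value just above the rank of the unperturbed map. -/
theorem singularValue_le_of_finrank_le {U : Submodule ℝ (EuclideanSpace ℝ (Fin n))} {ε : ℝ}
    (hs : Antitone s) (hs0 : ∀ i, 0 ≤ s i)
    (hΦ : ∀ a, ‖Φ a‖ ^ 2 = ∑ i, s i ^ 2 * inner ℝ (u i) a ^ 2)
    (hΨ : ∀ a ∈ Uᗮ, Ψ a = 0) (hε : ∀ a, ‖Φ a - Ψ a‖ ≤ ε * ‖a‖)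
    (m : Fin n) (hU : Module.finrank ℝ U ≤ m) : s m ≤ ε := by
  let f : (Fin (m + 1) → ℝ) →ₗ[ℝ] EuclideanSpace ℝ (Fin n) :=
    Fintype.linearCombination ℝ (fun i : Fin (m + 1) => u (Fin.castLE m.2 i))
  have hinj : Function.Injective f := by
    have h : LinearIndependent ℝ (fun i : Fin (m + 1) => u (Fin.castLE m.2 i)) :=
      (u.orthonormal.comp _ (Fin.castLE_injective m.2)).linearIndependent
    exact (linearIndependent_iff_injective_fintypeLinearCombination).1 h
  -- Dimension count: the span of the first m + 1 singular vectors meets the complement of U, where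
  -- Φ is the whole error Φ − Ψ.
  obtain ⟨b, hb, hb0⟩ : ∃ b ∈ LinearMap.ker (U.orthogonalProjectionOnto.toLinearMap ∘ₗ f), b ≠ 0 := by
    refine (Submodule.ne_bot_iff _).1 (LinearMap.ker_ne_bot_of_finrank_lt ?_)
    simpa using Nat.lt_succ_of_le hU
  have hfb : f b ≠ 0 := fun h => hb0 (hinj (by simpa using h))
  have hfU : f b ∈ Uᗮ := by
    rw [← Submodule.orthogonalProjectionOnto_eq_zero_iff]
    simpa using hb
  have h1 := le_norm_apply_of_inner_eq_zero (Φ := Φ) hs hs0 hΦ m (a := f b) (by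
    intro i hi
    simp only [f, Fintype.linearCombination_apply, inner_sum, inner_smul_right]
    refine Finset.sum_eq_zero fun j _ => ?_
    rw [u.inner_eq_ite, if_neg, mul_zero]
    rintro rfl
    have := j.2
    simp [Fin.lt_def] at hi
    omega)
  have h2 := hε (f b)
  rw [hΨ _ hfU, sub_zero] at h2
  exact le_of_mul_le_mul_right (h1.trans h2) (norm_pos_iff.2 hfb)

/-- Weyl's inequality for the last singular value within the rank of the unperturbed map. -/
theorem sub_le_singularValue {U : Submodule ℝ (EuclideanSpace ℝ (Fin n))} {ε S : ℝ}
    (hs : Antitone s) (hs0 : ∀ i, 0 ≤ s i)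
    (hΦ : ∀ a, ‖Φ a‖ ^ 2 = ∑ i, s i ^ 2 * inner ℝ (u i) a ^ 2)
    (hΨ : ∀ a ∈ U, S * ‖a‖ ≤ ‖Ψ a‖) (hε : ∀ a, ‖Φ a - Ψ a‖ ≤ ε * ‖a‖)
    (m : Fin n) (hU : m < Module.finrank ℝ U) : S - ε ≤ s m := by
  let f : U →ₗ[ℝ] (Fin m → ℝ) :=
    LinearMap.pi fun i => (innerₛₗ ℝ (u (Fin.castLE m.2.le i))) ∘ₗ U.subtype
  -- Dimension count: U contains a nonzero vector orthogonal to the first m singular vectors.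
  obtain ⟨a, ha, ha0⟩ : ∃ a ∈ LinearMap.ker f, a ≠ 0 := by
    refine (Submodule.ne_bot_iff _).1 (LinearMap.ker_ne_bot_of_finrank_lt ?_)
    simpa using hU
  have h1 := norm_apply_le_of_inner_eq_zero (Φ := Φ) hs hs0 hΦ m (a := a) (by
    intro i hi
    have := congrFun (LinearMap.mem_ker.1 ha) ⟨i, hi⟩
    simpa [f] using this)
  have h2 := hΨ a a.2
  have h3 := norm_sub_norm_le (Ψ a) (Φ a)
  rw [norm_sub_rev] at h3
  have h4 := hε a
  have ha' : 0 < ‖(a : EuclideanSpace ℝ (Fin n))‖ := by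
    rw [norm_pos_iff]; simpa using ha0
  refine le_of_mul_le_mul_right ?_ ha'
  linarith

theorem inner_eq_zero_of_mem_orthogonal_span {r : ℕ} {a : EuclideanSpace ℝ (Fin n)}
    (ha : a ∈ (Submodule.span ℝ (u '' {i | (i : ℕ) < r}))ᗮ) {i : Fin n} (hi : (i : ℕ) < r) :
    inner ℝ (u i) a = 0 :=
  (Submodule.mem_orthogonal _ _).1 ha _ (Submodule.subset_span ⟨i, hi, rfl⟩)

/-- A bounded below map hits everything through its adjoint. -/
theorem exists_inner_eq_of_bounded_below {U : Submodule ℝ (EuclideanSpace ℝ (Fin n))} {S : ℝ}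
    (hS : 0 < S) (hΨ0 : ∀ a ∈ Uᗮ, Ψ a = 0) (hΨ : ∀ a ∈ U, S * ‖a‖ ≤ ‖Ψ a‖)
    {v : EuclideanSpace ℝ (Fin n)} (hv : v ∈ U) :
    ∃ g : F, S * ‖g‖ ≤ ‖v‖ ∧ ∀ a, inner ℝ v a = inner ℝ g (Ψ a) := by
  let R : Submodule ℝ F := LinearMap.range Ψ
  let f : U →ₗ[ℝ] R := Ψ.rangeRestrict ∘ₗ U.subtype
  have hf : ∀ a : U, S * ‖a‖ ≤ ‖f a‖ := fun a => hΨ a a.2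
  have hinj : Function.Injective (LinearMap.adjoint f ∘ₗ f) := by
    rw [← LinearMap.ker_eq_bot, LinearMap.ker_eq_bot']
    intro a ha
    have h1 : inner ℝ (f a) (f a) = (0 : ℝ) := by
      rw [← LinearMap.adjoint_inner_left]
      have : LinearMap.adjoint f (f a) = 0 := ha
      rw [this, inner_zero_left]
    rw [inner_self_eq_zero] at h1
    have h2 := hf a
    rw [h1, norm_zero] at h2
    have : ‖a‖ ≤ 0 := by nlinarith [norm_nonneg a]
    simpa using this
  -- Solve f*f b = v, so that g = f b is the preimage of v under the adjoint that lies in the range.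
  obtain ⟨b, hb⟩ := (LinearMap.injective_iff_surjective.1 hinj) ⟨v, hv⟩
  have hb' : ∀ a : U, inner ℝ (⟨v, hv⟩ : U) a = inner ℝ (f b) (f a) := by
    intro a
    rw [← hb, LinearMap.comp_apply, LinearMap.adjoint_inner_left]
  refine ⟨f b, ?_, fun a => ?_⟩
  · have h1 : ‖f b‖ ^ 2 ≤ ‖v‖ * ‖b‖ := by
      rw [← real_inner_self_eq_norm_sq, ← hb' b]
      exact real_inner_le_norm _ _
    have h2 := hf b
    rcases (norm_nonneg (f b)).eq_or_lt with h | h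
    · rw [← Submodule.coe_norm, ← h, mul_zero]; exact norm_nonneg _
    · rw [← Submodule.coe_norm]
      refine le_of_mul_le_mul_right ?_ h
      nlinarith [norm_nonneg v]
  · have h1 : a = U.starProjection a + Uᗮ.starProjection a := by simp
    have h2 : inner ℝ v a = inner ℝ v (U.starProjection a) := by
      conv_lhs => rw [h1]
      rw [inner_add_right, Submodule.inner_right_of_mem_orthogonal hv
        (Submodule.starProjection_apply_mem _ _), add_zero]
    have h3 : Ψ a = Ψ (U.starProjection a) := by
      conv_lhs => rw [h1]
      rw [map_add, hΨ0 _ (Submodule.starProjection_apply_mem _ _), add_zero]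
    rw [h2, h3]
    exact hb' ⟨U.starProjection a, Submodule.starProjection_apply_mem _ _⟩

/-- A Wedin type bound for the span of the top left singular vectors. -/
theorem norm_starProjection_orthogonal_topSpace_le
    {U : Submodule ℝ (EuclideanSpace ℝ (Fin n))} {ε S : ℝ}
    (hs : Antitone s) (hs0 : ∀ i, 0 ≤ s i)
    (hΦ : ∀ a, ‖Φ a‖ ^ 2 = ∑ i, s i ^ 2 * inner ℝ (u i) a ^ 2) (hS : 0 < S)
    (hΨ0 : ∀ a ∈ Uᗮ, Ψ a = 0) (hΨ : ∀ a ∈ U, S * ‖a‖ ≤ ‖Ψ a‖)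
    (hε : ∀ a, ‖Φ a - Ψ a‖ ≤ ε * ‖a‖) (hε0 : 0 ≤ ε) (hU : Module.finrank ℝ U ≤ r)
    {v : EuclideanSpace ℝ (Fin n)} (hv : v ∈ U) :
    ‖(Submodule.span ℝ (u '' {i | (i : ℕ) < r}))ᗮ.starProjection v‖ ≤ 2 * ε / S * ‖v‖ := by
  set V' := Submodule.span ℝ (u '' {i | (i : ℕ) < r})
  set a := V'ᗮ.starProjection v with ha
  have haV : a ∈ V'ᗮ := Submodule.starProjection_apply_mem _ _
  -- The vector a lies beyond the first r singular directions, and the next singular value (index r,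
  -- counted from 0) is at most ε. If r ≥ n there are no such directions and a = 0.
  have h1 : ‖Φ a‖ ≤ ε * ‖a‖ := by
    by_cases hrn : r < n
    · refine (norm_apply_le_of_inner_eq_zero (Φ := Φ) hs hs0 hΦ ⟨r, hrn⟩ fun i hi =>
        inner_eq_zero_of_mem_orthogonal_span haV hi).trans ?_
      gcongr
      exact singularValue_le_of_finrank_le hs hs0 hΦ hΨ0 hε ⟨r, hrn⟩ hU
    · have : a = 0 := by
        rw [← norm_eq_zero, ← sq_eq_zero_iff, sq_norm_eq_sum_inner_sq u]
        refine Finset.sum_eq_zero fun i _ => ?_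
        rw [inner_eq_zero_of_mem_orthogonal_span haV (by omega)]
        simp
      simp [this]
  obtain ⟨g, hg, hga⟩ := exists_inner_eq_of_bounded_below hS hΨ0 hΨ hv
  have h2 : ‖a‖ ^ 2 ≤ ‖g‖ * ‖Ψ a‖ := by
    have : ‖a‖ ^ 2 = inner ℝ v a := by
      rw [← real_inner_self_eq_norm_sq, ha, ← Submodule.inner_starProjection_left_eq_right,
        Submodule.starProjection_eq_self_iff.2 haV, real_inner_comm, ha]
    rw [this, hga]
    exact real_inner_le_norm _ _
  have h3 : ‖Ψ a‖ ≤ 2 * ε * ‖a‖ := by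
    have := norm_sub_norm_le (Ψ a) (Φ a)
    rw [norm_sub_rev] at this
    linarith [hε a]
  rcases (norm_nonneg a).eq_or_lt with h | h
  · rw [← h]; positivity
  · rw [div_mul_eq_mul_div, le_div_iff₀ hS]
    refine le_of_mul_le_mul_right ?_ h
    calc ‖a‖ * S * ‖a‖ = S * ‖a‖ ^ 2 := by ring
      _ ≤ S * (‖g‖ * (2 * ε * ‖a‖)) := by gcongr; exact h2.trans (by gcongr)
      _ = S * ‖g‖ * (2 * ε * ‖a‖) := by ring
      _ ≤ ‖v‖ * (2 * ε * ‖a‖) := by gcongr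
      _ = _ := by ring

/-- Each of the first m + 1 coordinates is stretched by at least `s m`. For a standard basis vector
the right side is the norm of a row, so small rows force an incoherent top space. -/
theorem singularValue_mul_norm_starProjection_topSpace_le
    (hs : Antitone s) (hs0 : ∀ i, 0 ≤ s i)
    (hΦ : ∀ a, ‖Φ a‖ ^ 2 = ∑ i, s i ^ 2 * inner ℝ (u i) a ^ 2) (m : Fin n)
    (a : EuclideanSpace ℝ (Fin n)) :
    s m * ‖(Submodule.span ℝ (u '' {i | (i : ℕ) < m + 1})).starProjection a‖ ≤ ‖Φ a‖ := by
  refine le_of_sq_le_sq ?_ (norm_nonneg _)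
  rw [hΦ, mul_pow, sq_norm_eq_sum_inner_sq u, Finset.mul_sum]
  refine Finset.sum_le_sum fun i _ => ?_
  rw [← Submodule.inner_starProjection_left_eq_right]
  by_cases hi : (i : ℕ) < m + 1
  · have hu : u i ∈ Submodule.span ℝ (u '' {i | (i : ℕ) < m + 1}) :=
      Submodule.subset_span ⟨i, hi, rfl⟩
    rw [Submodule.starProjection_eq_self_iff.2 hu]
    have := hs0 m
    have : s m ≤ s i := hs (by rw [Fin.le_def]; omega)
    gcongr
  · have : u i ∈ (Submodule.span ℝ (u '' {i | (i : ℕ) < m + 1}))ᗮ := by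
      rw [Submodule.mem_orthogonal]
      intro w hw
      induction hw using Submodule.span_induction with
      | mem w hw =>
        obtain ⟨j, hj, rfl⟩ := hw
        rw [u.inner_eq_ite, if_neg]
        rintro rfl
        exact hi hj
      | zero => simp
      | add x y _ _ hx hy => rw [inner_add_left, hx, hy, add_zero]
      | smul c x _ hx => rw [inner_smul_left, hx, mul_zero]
    rw [(Submodule.starProjection_apply_eq_zero_iff _).2 this]
    rw [inner_zero_left, zero_pow two_ne_zero, mul_zero]
    positivity

end Perturbation

/-! ### Kronecker products of vectors and subspaces -/

section Tensor

variable {n r : ℕ}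

@[simp] theorem outer_apply (v w : EuclideanSpace ℝ (Fin n)) (q : Fin n × Fin n) :
    outer v w q = v q.1 * w q.2 := rfl

theorem inner_outer (v w v' w' : EuclideanSpace ℝ (Fin n)) :
    inner ℝ (outer v w) (outer v' w') = (inner ℝ v v' * inner ℝ w w' : ℝ) := by
  simp only [PiLp.inner_apply, Fintype.sum_prod_type, outer_apply, Finset.sum_mul_sum]
  refine Finset.sum_congr rfl fun a _ => Finset.sum_congr rfl fun b _ => ?_
  simp
  ring

theorem norm_outer (v w : EuclideanSpace ℝ (Fin n)) : ‖outer v w‖ = ‖v‖ * ‖w‖ := by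
  rw [← sq_eq_sq₀ (norm_nonneg _) (by positivity), ← real_inner_self_eq_norm_sq, inner_outer,
    real_inner_self_eq_norm_sq, real_inner_self_eq_norm_sq]
  ring

theorem outer_mem_tensorSpace {V W : Submodule ℝ (EuclideanSpace ℝ (Fin n))}
    {v w : EuclideanSpace ℝ (Fin n)} (hv : v ∈ V) (hw : w ∈ W) : outer v w ∈ tensorSpace V W :=
  Submodule.subset_span ⟨v, hv, w, hw, rfl⟩

/-- The projection onto a tensor product is the tensor product of the projections; it suffices to
test orthogonality on the generators. -/
theorem starProjection_tensorSpace_outer (V W : Submodule ℝ (EuclideanSpace ℝ (Fin n)))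
    (v w : EuclideanSpace ℝ (Fin n)) :
    (tensorSpace V W).starProjection (outer v w) =
      outer (V.starProjection v) (W.starProjection w) := by
  refine Submodule.eq_starProjection_of_mem_of_inner_eq_zero (K := tensorSpace V W)
    (outer_mem_tensorSpace (Submodule.starProjection_apply_mem _ _)
      (Submodule.starProjection_apply_mem _ _)) fun t ht => ?_
  induction ht using Submodule.span_induction with
  | mem t ht =>
    obtain ⟨v', hv', w', hw', rfl⟩ := ht
    rw [inner_sub_left, inner_outer, inner_outer, Submodule.inner_starProjection_left_eq_right,
      Submodule.inner_starProjection_left_eq_right, Submodule.starProjection_eq_self_iff.2 hv',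
      Submodule.starProjection_eq_self_iff.2 hw', sub_self]
  | zero => simp
  | add x y _ _ hx hy => rw [inner_add_right, hx, hy, add_zero]
  | smul c x _ hx => rw [inner_smul_right, hx, mul_zero]

theorem single_eq_outer (q : Fin n × Fin n) :
    (EuclideanSpace.single q (1 : ℝ)) =
      outer (EuclideanSpace.single q.1 1) (EuclideanSpace.single q.2 1) := by
  ext ⟨a, b⟩
  obtain ⟨c, d⟩ := q
  simp only [outer_apply, PiLp.single_apply, Prod.mk.injEq]
  split_ifs <;> simp_all

theorem norm_starProjection_tensorSpace_single_le {V W : Submodule ℝ (EuclideanSpace ℝ (Fin n))}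
    {μ : ℝ} (hV : IsIncoherent μ V) (hW : IsIncoherent μ W) (hVr : Module.finrank ℝ V = r)
    (hWr : Module.finrank ℝ W = r) (q : Fin n × Fin n) :
    ‖(tensorSpace V W).starProjection (EuclideanSpace.single q 1)‖ ≤ √(μ * r / n) ^ 2 := by
  rw [single_eq_outer, starProjection_tensorSpace_outer, norm_outer, sq]
  have h1 := hV q.1
  have h2 := hW q.2
  rw [hVr] at h1
  rw [hWr] at h2
  gcongr
  · exact h1
  · exact h2

/-- Cutting the n × n array into slices turns inequalities for sums of y_i ⊗ z_i into inequalities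
for sums of y_i with modified coefficients. -/
theorem norm_sum_outer_sq (d : Fin r → ℝ) (y z : Fin r → EuclideanSpace ℝ (Fin n)) :
    ‖∑ i, d i • outer (y i) (z i)‖ ^ 2 = ∑ b, ‖∑ i, (d i * z i b) • y i‖ ^ 2 := by
  simp only [EuclideanSpace.norm_sq_eq, Fintype.sum_prod_type]
  rw [Finset.sum_comm]
  refine Finset.sum_congr rfl fun b _ => Finset.sum_congr rfl fun a _ => ?_
  congr 2
  simp only [WithLp.ofLp_sum, Finset.sum_apply, PiLp.smul_apply, outer_apply, smul_eq_mul]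
  exact Finset.sum_congr rfl fun i _ => by ring

theorem norm_sum_outer_sq' (d : Fin r → ℝ) (y z : Fin r → EuclideanSpace ℝ (Fin n)) :
    ‖∑ i, d i • outer (y i) (z i)‖ ^ 2 = ∑ a, ‖∑ i, (d i * y i a) • z i‖ ^ 2 := by
  simp only [EuclideanSpace.norm_sq_eq, Fintype.sum_prod_type]
  refine Finset.sum_congr rfl fun b _ => Finset.sum_congr rfl fun a _ => ?_
  congr 2
  simp only [WithLp.ofLp_sum, Finset.sum_apply, PiLp.smul_apply, outer_apply, smul_eq_mul]
  exact Finset.sum_congr rfl fun i _ => by ring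

theorem norm_sum_outer_le_left {K : ℝ} (hK : 0 ≤ K) {y y' : Fin r → EuclideanSpace ℝ (Fin n)}
    (h : ∀ d : Fin r → ℝ, ‖∑ i, d i • y' i‖ ≤ K * ‖∑ i, d i • y i‖)
    (d : Fin r → ℝ) (z : Fin r → EuclideanSpace ℝ (Fin n)) :
    ‖∑ i, d i • outer (y' i) (z i)‖ ≤ K * ‖∑ i, d i • outer (y i) (z i)‖ := by
  refine le_of_sq_le_sq ?_ (by positivity)
  rw [mul_pow, norm_sum_outer_sq, norm_sum_outer_sq, Finset.mul_sum]
  refine Finset.sum_le_sum fun b _ => ?_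
  rw [← mul_pow]
  have := h fun i => d i * z i b
  gcongr

theorem norm_sum_outer_le_right {K : ℝ} (hK : 0 ≤ K) {z z' : Fin r → EuclideanSpace ℝ (Fin n)}
    (h : ∀ d : Fin r → ℝ, ‖∑ i, d i • z' i‖ ≤ K * ‖∑ i, d i • z i‖)
    (d : Fin r → ℝ) (y : Fin r → EuclideanSpace ℝ (Fin n)) :
    ‖∑ i, d i • outer (y i) (z' i)‖ ≤ K * ‖∑ i, d i • outer (y i) (z i)‖ := by
  refine le_of_sq_le_sq ?_ (by positivity)
  rw [mul_pow, norm_sum_outer_sq', norm_sum_outer_sq', Finset.mul_sum]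
  refine Finset.sum_le_sum fun b _ => ?_
  rw [← mul_pow]
  have := h fun i => d i * y i b
  gcongr

/-- Apply the bound for y in every slice; summing over the slices restores ‖d‖² because each z_i is
a unit vector. No independence of the z_i is needed. -/
theorem le_norm_sum_outer {c : ℝ} (hc : 0 ≤ c) {y z : Fin r → EuclideanSpace ℝ (Fin n)}
    (hy : ∀ d : EuclideanSpace ℝ (Fin r), c * ‖d‖ ≤ ‖∑ i, d i • y i‖) (hz : ∀ i, ‖z i‖ = 1)
    (d : EuclideanSpace ℝ (Fin r)) : c * ‖d‖ ≤ ‖∑ i, d i • outer (y i) (z i)‖ := by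
  refine le_of_sq_le_sq ?_ (by positivity)
  rw [norm_sum_outer_sq]
  have h1 : ∀ b, c ^ 2 * ∑ i, (d i * z i b) ^ 2 ≤ ‖∑ i, (d i * z i b) • y i‖ ^ 2 := by
    intro b
    have := hy (WithLp.toLp 2 fun i => d i * z i b)
    have h2 : ‖(WithLp.toLp 2 fun i => d i * z i b : EuclideanSpace ℝ (Fin r))‖ ^ 2 =
      ∑ i, (d i * z i b) ^ 2 := by
      simp only [EuclideanSpace.norm_sq_eq, Real.norm_eq_abs, sq_abs]
    rw [← h2, ← mul_pow]
    gcongr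
  refine le_trans ?_ (Finset.sum_le_sum fun b _ => h1 b)
  rw [← Finset.mul_sum, Finset.sum_comm, mul_pow]
  gcongr
  rw [EuclideanSpace.norm_sq_eq]
  refine Finset.sum_le_sum fun i _ => ?_
  have : ∑ b, (d i * z i b) ^ 2 = d i ^ 2 * ‖z i‖ ^ 2 := by
    simp [EuclideanSpace.norm_sq_eq, Finset.mul_sum, mul_pow]
  rw [this, hz]
  simp

/-- The part of `∑ i, d i • (y i ⊗ z i)` outside of `V ⊗ W` is small if the spans of the factors
are close to `V` and `W`. -/
theorem norm_sub_starProjection_tensorSpace_le {V W : Submodule ℝ (EuclideanSpace ℝ (Fin n))}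
    {y z : Fin r → EuclideanSpace ℝ (Fin n)} {α : ℝ}
    (hV : sinAngle (Submodule.span ℝ (Set.range y)) V ≤ α)
    (hW : sinAngle (Submodule.span ℝ (Set.range z)) W ≤ α) (d : Fin r → ℝ) :
    ‖∑ i, d i • outer (y i) (z i) -
      (tensorSpace V W).starProjection (∑ i, d i • outer (y i) (z i))‖ ≤
        2 * α * ‖∑ i, d i • outer (y i) (z i)‖ := by
  have hα : 0 ≤ α := (sinAngle_nonneg _ _).trans hV
  have key : ∀ (V : Submodule ℝ (EuclideanSpace ℝ (Fin n))) (y : Fin r → EuclideanSpace ℝ (Fin n)),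
      sinAngle (Submodule.span ℝ (Set.range y)) V ≤ α → ∀ d : Fin r → ℝ,
      ‖∑ i, d i • (y i - V.starProjection (y i))‖ ≤ α * ‖∑ i, d i • y i‖ := by
    intro V y hV d
    have h1 : ∑ i, d i • (y i - V.starProjection (y i)) =
        Vᗮ.starProjection (∑ i, d i • y i) := by
      simp [map_sum, Submodule.starProjection_orthogonal_val]
    rw [h1]
    refine (norm_starProjection_orthogonal_le_sinAngle _ V
      (Submodule.sum_mem _ fun i _ => Submodule.smul_mem _ _
        (Submodule.subset_span (Set.mem_range_self i)))).trans ?_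
    gcongr
  -- The telescoping 1 − P ⊗ Q = (1 − P) ⊗ 1 + P ⊗ (1 − Q) replaces one factor at a time; each term
  -- costs one α.
  have h1 : ∑ i, d i • outer (y i) (z i) -
      (tensorSpace V W).starProjection (∑ i, d i • outer (y i) (z i)) =
      ∑ i, d i • outer (y i - V.starProjection (y i)) (z i) +
      ∑ i, d i • outer (V.starProjection (y i)) (z i - W.starProjection (z i)) := by
    simp only [map_sum, map_smul, starProjection_tensorSpace_outer]
    rw [← Finset.sum_sub_distrib, ← Finset.sum_add_distrib]
    refine Finset.sum_congr rfl fun i _ => ?_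
    ext q
    simp
    ring
  rw [h1]
  refine (norm_add_le _ _).trans ?_
  have h2 := norm_sum_outer_le_left hα (key V y hV) d z
  have h3 := norm_sum_outer_le_right hα (key W z hW) d (fun i => V.starProjection (y i))
  have h4 := norm_sum_outer_le_left (K := 1) zero_le_one (y := y)
    (y' := fun i => V.starProjection (y i)) (by
      intro d
      have : ∑ i, d i • V.starProjection (y i) = V.starProjection (∑ i, d i • y i) := by
        simp [map_sum]
      rw [this, one_mul]
      exact Submodule.norm_starProjection_apply_le _ _) d z
  have h5 : α * ‖∑ i, d i • outer (V.starProjection (y i)) (z i)‖ ≤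
      α * (1 * ‖∑ i, d i • outer (y i) (z i)‖) := by gcongr
  linarith

end Tensor

/-! ### Consequences of robust independence and incoherence -/

section Factors

variable {n r : ℕ}

theorem smallestSingularValue_mul_norm_le (hr : 0 < r) (x : Fin r → EuclideanSpace ℝ (Fin n))
    (d : EuclideanSpace ℝ (Fin r)) :
    smallestSingularValue x * ‖d‖ ≤ ‖∑ i, d i • x i‖ := by
  set T := Matrix.toEuclideanLin (Matrix.of fun (j : Fin n) (i : Fin r) => x i j) with hT
  have h1 : T d = ∑ i, d i • x i := by
    ext j
    simp [T, Matrix.toEuclideanLin, Matrix.mulVec, dotProduct, mul_comm]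
  rw [← h1]
  have hn : Module.finrank ℝ (EuclideanSpace ℝ (Fin r)) = r := by simp
  refine le_of_sq_le_sq ?_ (norm_nonneg _)
  rw [mul_pow, smallestSingularValue, T.sq_singularValues_of_lt hn (Nat.sub_lt hr one_pos)]
  have hsym := T.isSymmetric_adjoint_comp_self
  set e := hsym.eigenvectorBasis hn
  have h2 : ‖T d‖ ^ 2 = ∑ i, hsym.eigenvalues hn i * inner ℝ (e i) d ^ 2 := by
    rw [← real_inner_self_eq_norm_sq, ← LinearMap.adjoint_inner_left, ← e.sum_inner_mul_inner]
    refine Finset.sum_congr rfl fun i _ => ?_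
    have h3 : inner ℝ ((LinearMap.adjoint T) (T d)) (e i) =
        hsym.eigenvalues hn i * inner ℝ (e i) d := by
      have h4 := hsym d (e i)
      rw [LinearMap.comp_apply] at h4
      rw [h4, hsym.apply_eigenvectorBasis, inner_smul_right, real_inner_comm]
      rfl
    rw [h3]; ring
  rw [h2, ← e.sum_sq_norm_inner_right d, Finset.mul_sum]
  refine Finset.sum_le_sum fun i _ => ?_
  rw [Real.norm_eq_abs, sq_abs]
  gcongr
  -- Eigenvalues are decreasing and indexed from 0, so r − 1 is the index of the smallest.
  exact hsym.eigenvalues_antitone hn (by rw [Fin.le_def]; simp; omega)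

theorem linearIndependent_of_lower_bound {c : ℝ} (hc : 0 < c)
    {x : Fin r → EuclideanSpace ℝ (Fin n)}
    (hx : ∀ d : EuclideanSpace ℝ (Fin r), c * ‖d‖ ≤ ‖∑ i, d i • x i‖) :
    LinearIndependent ℝ x := by
  rw [Fintype.linearIndependent_iff]
  intro g hg i
  have h1 := hx (WithLp.toLp 2 g)
  simp only [hg, norm_zero] at h1
  have h2 : ‖(WithLp.toLp 2 g : EuclideanSpace ℝ (Fin r))‖ = 0 :=
    le_antisymm (by nlinarith [norm_nonneg (WithLp.toLp 2 g : EuclideanSpace ℝ (Fin r))])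
      (norm_nonneg _)
  rw [norm_eq_zero] at h2
  have := congrArg (fun v : EuclideanSpace ℝ (Fin r) => v i) h2
  simpa using this

/-- On the span of its columns, the transposed matrix has the same lower bound: for a = Σ g_i x_i
one has ‖a‖² = Σ g_i⟨x_i, a⟩, and ‖g‖ ≤ ‖a‖/c. -/
theorem mul_norm_le_norm_inner_of_mem_span {c : ℝ}
    {x : Fin r → EuclideanSpace ℝ (Fin n)}
    (hx : ∀ d : EuclideanSpace ℝ (Fin r), c * ‖d‖ ≤ ‖∑ i, d i • x i‖)
    {a : EuclideanSpace ℝ (Fin n)} (ha : a ∈ Submodule.span ℝ (Set.range x)) :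
    c * ‖a‖ ≤ ‖(WithLp.toLp 2 fun i => inner ℝ (x i) a : EuclideanSpace ℝ (Fin r))‖ := by
  obtain ⟨g, rfl⟩ := (Submodule.mem_span_range_iff_exists_fun ℝ).1 ha
  set a := ∑ i, g i • x i with ha'
  set b : EuclideanSpace ℝ (Fin r) := WithLp.toLp 2 fun i => inner ℝ (x i) a
  have h1 := hx (WithLp.toLp 2 g)
  simp only [← ha'] at h1
  have h2 : ‖a‖ ^ 2 ≤ ‖b‖ * ‖(WithLp.toLp 2 g : EuclideanSpace ℝ (Fin r))‖ := by
    refine le_trans (le_of_eq ?_) (real_inner_le_norm _ _)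
    rw [← real_inner_self_eq_norm_sq]
    conv_lhs => rw [ha', sum_inner]
    simp only [inner_smul_left]
    simp [PiLp.inner_apply (𝕜 := ℝ) b, b]
    rfl
  rcases (norm_nonneg a).eq_or_lt with h | h
  · rw [← h, mul_zero]; exact norm_nonneg _
  · refine le_of_mul_le_mul_right ?_ h
    rcases le_or_gt c 0 with hc | hc
    · exact (mul_nonpos_of_nonpos_of_nonneg (mul_nonpos_of_nonpos_of_nonneg hc h.le) h.le).trans
        (by positivity)
    · nlinarith [norm_nonneg b]

theorem IsIncoherent.abs_apply_le {μ : ℝ} {V : Submodule ℝ (EuclideanSpace ℝ (Fin n))}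
    (hV : IsIncoherent μ V) (hVr : Module.finrank ℝ V = r) {v : EuclideanSpace ℝ (Fin n)}
    (hv : v ∈ V) (j : Fin n) : |v j| ≤ √(μ * r / n) * ‖v‖ := by
  have h1 : v j = inner ℝ (V.starProjection (EuclideanSpace.single j 1)) v := by
    rw [Submodule.inner_starProjection_left_eq_right, Submodule.starProjection_eq_self_iff.2 hv,
      EuclideanSpace.inner_single_left]
    simp
  have h2 := hV j
  rw [hVr] at h2
  rw [h1]
  refine (abs_real_inner_le_norm _ _).trans ?_
  gcongr
  simpa using h2

/-- The squared lengths of the projected basis vectors sum to the trace of the projection, which is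
r, so they cannot all be below r/n. -/
theorem IsIncoherent.one_le {μ : ℝ} {V : Submodule ℝ (EuclideanSpace ℝ (Fin n))}
    (hV : IsIncoherent μ V) (hVr : Module.finrank ℝ V = r) (hr : 0 < r) : 1 ≤ μ := by
  have hn : 0 < n := by
    rcases Nat.eq_zero_or_pos n with rfl | h
    · have := Submodule.finrank_le V
      rw [hVr, finrank_euclideanSpace_fin] at this
      omega
    · exact h
  let b := stdOrthonormalBasis ℝ V
  have h1 : ∑ j : Fin n, ‖V.orthogonalProjectionOnto (EuclideanSpace.single j (1 : ℝ))‖ ^ 2 = r := by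
    have h2 : ∀ j : Fin n, ‖V.orthogonalProjectionOnto (EuclideanSpace.single j (1 : ℝ))‖ ^ 2 =
        ∑ l, (b l : EuclideanSpace ℝ (Fin n)) j ^ 2 := by
      intro j
      rw [← b.sum_sq_norm_inner_right]
      refine Finset.sum_congr rfl fun l _ => ?_
      rw [Submodule.inner_orthogonalProjectionOnto_eq_of_mem_left, EuclideanSpace.inner_single_right]
      simp
    simp_rw [h2]
    rw [Finset.sum_comm]
    have h3 : ∀ l, ∑ j, (b l : EuclideanSpace ℝ (Fin n)) j ^ 2 = 1 := by
      intro l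
      have := b.norm_eq_one l
      rw [Submodule.coe_norm] at this
      have h4 := EuclideanSpace.norm_sq_eq (b l : EuclideanSpace ℝ (Fin n))
      rw [this] at h4
      simpa using h4.symm
    simp [h3, hVr]
  have h2 : (r : ℝ) ≤ n * √(μ * r / n) ^ 2 := by
    refine h1.symm.le.trans ?_
    refine (Finset.sum_le_card_nsmul Finset.univ _ (√(μ * r / n) ^ 2) fun j _ => ?_).trans
      (le_of_eq (by rw [nsmul_eq_mul, Finset.card_univ, Fintype.card_fin]))
    have := hV j
    rw [hVr] at this
    gcongr
  have hr' : (0 : ℝ) < r := by exact_mod_cast hr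
  have hn' : (0 : ℝ) < n := by exact_mod_cast hn
  rcases le_or_gt (μ * r / n) 0 with h | h
  · rw [Real.sqrt_eq_zero_of_nonpos h] at h2
    norm_num at h2
    omega
  · rw [Real.sq_sqrt h.le, mul_div_cancel₀ _ hn'.ne'] at h2
    nlinarith

end Factors

/-! ### Matrices as families of rows -/

section RowMap

variable {n : ℕ} {F : Type*} [NormedAddCommGroup F] [InnerProductSpace ℝ F]

/-- The linear map that combines the rows `w j` with the coefficients of a vector. -/
noncomputable def rowMap (w : Fin n → F) : EuclideanSpace ℝ (Fin n) →ₗ[ℝ] F where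
  toFun a := ∑ j, a j • w j
  map_add' a b := by simp [add_smul, Finset.sum_add_distrib]
  map_smul' c a := by simp [mul_smul, Finset.smul_sum]

theorem rowMap_apply (w : Fin n → F) (a : EuclideanSpace ℝ (Fin n)) :
    rowMap w a = ∑ j, a j • w j := rfl

theorem rowMap_single (w : Fin n → F) (j : Fin n) :
    rowMap w (EuclideanSpace.single j 1) = w j := by
  simp [rowMap_apply, PiLp.single_apply]

/-- The operator norm is at most the Frobenius norm, by Cauchy–Schwarz. -/
theorem norm_rowMap_sub_le {w w' : Fin n → F} {ε : ℝ} (hε : 0 ≤ ε)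
    (h : ∑ j, ‖w j - w' j‖ ^ 2 ≤ ε ^ 2) (a : EuclideanSpace ℝ (Fin n)) :
    ‖rowMap w a - rowMap w' a‖ ≤ ε * ‖a‖ := by
  have h1 : rowMap w a - rowMap w' a = ∑ j, a j • (w j - w' j) := by
    simp [rowMap_apply, smul_sub]
  refine le_of_sq_le_sq ?_ (by positivity)
  calc ‖rowMap w a - rowMap w' a‖ ^ 2 ≤ (∑ j, ‖a j‖ * ‖w j - w' j‖) ^ 2 := by
        rw [h1]
        gcongr
        exact (norm_sum_le _ _).trans (Finset.sum_le_sum fun j _ => (norm_smul _ _).le)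
    _ ≤ (∑ j, ‖a j‖ ^ 2) * ∑ j, ‖w j - w' j‖ ^ 2 := Finset.sum_mul_sq_le_sq_mul_sq _ _ _
    _ ≤ ‖a‖ ^ 2 * ε ^ 2 := by
        rw [EuclideanSpace.norm_sq_eq]
        gcongr
    _ = _ := by ring

end RowMap

/-! ### The least squares problem and its normal equations -/

section LeastSquares

variable {n r : ℕ}

/-- The entrywise product of a vector with the weights `m`. -/
noncomputable def mask {ι : Type*} (m : ι → ℝ) (v : EuclideanSpace ℝ ι) : EuclideanSpace ℝ ι :=
  WithLp.toLp 2 fun q => m q * v q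

theorem inner_mask {ι : Type*} [Fintype ι] (m : ι → ℝ) (v w : EuclideanSpace ℝ ι) :
    inner ℝ (mask m v) w = ∑ q, m q * v q * w q := by
  simp only [PiLp.inner_apply, mask]
  exact Finset.sum_congr rfl fun q _ => by simp; ring

theorem obs_nonneg {ι : Type*} (S : Set ι) (i : ι) : 0 ≤ obs S i :=
  Set.indicator_nonneg (fun _ _ => zero_le_one) i

theorem observedLoss_eq {n m : ℕ} (U : Matrix (Fin n) (Fin n × Fin n) ℝ) (S : Set (Entry n))
    (entry : Fin n → Fin n × Fin n → Entry n) (B : Matrix (Fin m) (Fin n × Fin n) ℝ)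
    (H : Matrix (Fin n) (Fin m) ℝ) :
    observedLoss U {q | entry q.1 q.2 ∈ S} B H =
      ∑ j, ∑ q, obs S (entry j q) * (U j q - (H * B) j q) ^ 2 := by
  rw [observedLoss, ← Finset.sum_product']
  refine Finset.sum_congr rfl fun q _ => ?_
  classical
  rw [obs_eq_ite, Set.indicator_apply]
  simp

theorem eq_zero_of_forall_quadratic_nonneg {A C : ℝ} (hC : 0 ≤ C)
    (h : ∀ t : ℝ, 0 ≤ -2 * t * A + t ^ 2 * C) : A = 0 := by
  -- The minimiser A/C is not available for C = 0; A/(C + 1) already makes the quadratic negative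
  -- unless A = 0.
  have h1 := h (A / (C + 1))
  have h2 : -2 * (A / (C + 1)) * A + (A / (C + 1)) ^ 2 * C = -((C + 2) * (A / (C + 1)) ^ 2) := by
    field_simp
    ring
  rw [h2] at h1
  have h3 : (A / (C + 1)) ^ 2 = 0 := by nlinarith [sq_nonneg (A / (C + 1))]
  have h4 : A / (C + 1) = 0 := by simpa using h3
  rcases div_eq_zero_iff.1 h4 with h | h
  · exact h
  · linarith

/-- The row of `H B` with the coefficients `h`. -/
noncomputable def rowVec (B : Matrix (Fin r) (Fin n × Fin n) ℝ) (h : Fin r → ℝ) :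
    EuclideanSpace ℝ (Fin n × Fin n) :=
  ∑ l, h l • (WithLp.toLp 2 (B l) : EuclideanSpace ℝ (Fin n × Fin n))

theorem rowVec_apply (B : Matrix (Fin r) (Fin n × Fin n) ℝ) (H : Matrix (Fin n) (Fin r) ℝ)
    (j : Fin n) (q : Fin n × Fin n) : rowVec B (H j) q = (H * B) j q := by
  simp [rowVec, Matrix.mul_apply]

/-- The normal equations of the least squares problem. -/
theorem sum_obs_mul_eq_zero_of_isMin {U : Fin n → EuclideanSpace ℝ (Fin n × Fin n)}
    {S : Set (Entry n)} {entry : Fin n → Fin n × Fin n → Entry n}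
    {B : Matrix (Fin r) (Fin n × Fin n) ℝ} {H : Matrix (Fin n) (Fin r) ℝ}
    (hmin : ∀ H' : Matrix (Fin n) (Fin r) ℝ,
      observedLoss (Matrix.of fun j q => U j q) {q | entry q.1 q.2 ∈ S} B H ≤
        observedLoss (Matrix.of fun j q => U j q) {q | entry q.1 q.2 ∈ S} B H')
    (j₀ : Fin n) (h : Fin r → ℝ) :
    ∑ q, obs S (entry j₀ q) * (U j₀ q - rowVec B (H j₀) q) * rowVec B h q = 0 := by
  classical
  set v := rowVec B h with hv
  -- Only row j₀ is perturbed, so the losses of all other rows cancel and the problem decouples.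
  let Δ : Matrix (Fin n) (Fin r) ℝ := Matrix.of fun j l => if j = j₀ then h l else 0
  have hΔ : ∀ j q, (Δ * B) j q = if j = j₀ then v q else 0 := by
    intro j q
    simp only [hv, rowVec, Matrix.mul_apply, Δ, Matrix.of_apply]
    split_ifs <;> simp
  refine eq_zero_of_forall_quadratic_nonneg (C := ∑ q, obs S (entry j₀ q) * v q ^ 2)
    (Finset.sum_nonneg fun q _ => mul_nonneg (obs_nonneg _ _) (sq_nonneg _)) fun t => ?_
  have h1 := hmin (H + t • Δ)
  rw [observedLoss_eq, observedLoss_eq, ← sub_nonneg, ← Finset.sum_sub_distrib] at h1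
  rw [Finset.sum_eq_single j₀] at h1
  · refine h1.trans (le_of_eq ?_)
    rw [← Finset.sum_sub_distrib, Finset.mul_sum, Finset.mul_sum, ← Finset.sum_add_distrib]
    refine Finset.sum_congr rfl fun q _ => ?_
    rw [Matrix.of_apply, Matrix.add_mul, Matrix.smul_mul, Matrix.add_apply, Matrix.smul_apply,
      hΔ, rowVec_apply]
    simp
    ring
  · intro j _ hj
    rw [← Finset.sum_sub_distrib]
    refine Finset.sum_eq_zero fun q _ => ?_
    rw [Matrix.of_apply, Matrix.add_mul, Matrix.smul_mul, Matrix.add_apply, Matrix.smul_apply, hΔ]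
    simp [hj]
  · simp

/-- Since the rows of B are orthonormal, H and H B have the same left singular values and vectors.
The choice of B thus disappears, and the rows can be compared in ℝ^{n²}. -/
theorem norm_rowMap_rowVec_sq {B : Matrix (Fin r) (Fin n × Fin n) ℝ}
    (hB : Orthonormal ℝ fun i => (WithLp.toLp 2 (B i) : EuclideanSpace ℝ (Fin n × Fin n)))
    (H : Matrix (Fin n) (Fin r) ℝ) (a : EuclideanSpace ℝ (Fin n)) :
    ‖rowMap (fun j => rowVec B (H j)) a‖ ^ 2 =
      inner ℝ a (Matrix.toEuclideanLin (H * H.transpose) a) := by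
  have h1 : rowMap (fun j => rowVec B (H j)) a = ∑ l, (∑ j, a j * H j l) •
      (WithLp.toLp 2 (B l) : EuclideanSpace ℝ (Fin n × Fin n)) := by
    simp only [rowMap_apply, rowVec, Finset.smul_sum, Finset.sum_smul, smul_smul]
    rw [Finset.sum_comm]
  rw [h1, ← real_inner_self_eq_norm_sq, hB.inner_sum]
  simp only [PiLp.inner_apply, Matrix.toEuclideanLin]
  simp only [RCLike.inner_apply, conj_trivial, Matrix.toLpLin_apply, Matrix.mulVec, dotProduct,
    Matrix.mul_apply, Matrix.transpose_apply, Finset.sum_mul, Finset.mul_sum]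
  rw [Finset.sum_comm]
  refine Finset.sum_congr rfl fun j _ => ?_
  rw [Finset.sum_comm]
  refine Finset.sum_congr rfl fun j' _ => Finset.sum_congr rfl fun l _ => ?_
  ring

theorem inner_apply_eq_sum_of_eigenbasis {E : Type*} [NormedAddCommGroup E] [InnerProductSpace ℝ E]
    {ι : Type*} [Fintype ι] (u : OrthonormalBasis ι ℝ E) {s : ι → ℝ} {G : E →ₗ[ℝ] E}
    (hG : ∀ i, G (u i) = (s i ^ 2) • u i) (a : E) :
    inner ℝ a (G a) = ∑ i, s i ^ 2 * inner ℝ (u i) a ^ 2 := by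
  conv_lhs => rw [← u.sum_repr' a]
  simp only [map_sum, map_smul, hG, smul_smul]
  rw [u.orthonormal.inner_sum]
  refine Finset.sum_congr rfl fun i _ => ?_
  simp
  ring

theorem finrank_of_isTopLeftSingularSpace {m : ℕ} {H : Matrix (Fin n) (Fin m) ℝ}
    {V : Submodule ℝ (EuclideanSpace ℝ (Fin n))} (h : IsTopLeftSingularSpace r H V) :
    Module.finrank ℝ V = r := by
  obtain ⟨hrn, u, s, -, -, -, rfl⟩ := h
  have h1 : u '' {i | (i : ℕ) < r} = Set.range (u ∘ Fin.castLE hrn) := by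
    ext v
    constructor
    · rintro ⟨i, hi, rfl⟩
      exact ⟨⟨i, hi⟩, rfl⟩
    · rintro ⟨i, rfl⟩
      exact ⟨Fin.castLE hrn i, i.2, rfl⟩
  rw [h1, finrank_span_eq_card]
  · simp
  · exact (u.orthonormal.comp _ (Fin.castLE_injective hrn)).linearIndependent

end LeastSquares

/-! ### Weighted least squares in a subspace -/

section RowEstimates

variable {ι : Type*} [Fintype ι] {K : Submodule ℝ (EuclideanSpace ℝ ι)} {m : ι → ℝ}
  {v w : EuclideanSpace ℝ ι} {lam : ℝ}

/-- The least squares solution `w` for the data `v` in the subspace `K`, with weights `m`, is close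
to the orthogonal projection of `v`. -/
theorem norm_sub_starProjection_le_of_normal
    (hK : ∀ t ∈ K, lam * ‖t‖ ^ 2 ≤ ∑ q, m q * t q ^ 2) (hw : w ∈ K)
    (hnormal : ∀ t ∈ K, ∑ q, m q * (v q - w q) * t q = 0) :
    lam * ‖w - K.starProjection v‖ ≤ ‖K.starProjection (mask m (v - K.starProjection v))‖ := by
  set d := w - K.starProjection v with hd
  have hdK : d ∈ K := K.sub_mem hw (Submodule.starProjection_apply_mem _ _)
  -- The normal equations are tested against the error d itself.
  have h1 : ∑ q, m q * d q ^ 2 = inner ℝ (mask m (v - K.starProjection v)) d := by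
    rw [inner_mask, ← sub_eq_zero, ← Finset.sum_sub_distrib, ← neg_eq_zero,
      ← Finset.sum_neg_distrib, ← hnormal d hdK]
    refine Finset.sum_congr rfl fun q _ => ?_
    simp [hd]
    ring
  have h2 : inner ℝ (mask m (v - K.starProjection v)) d =
      inner ℝ (K.starProjection (mask m (v - K.starProjection v))) d := by
    rw [Submodule.inner_starProjection_left_eq_right, Submodule.starProjection_eq_self_iff.2 hdK]
  have h3 := real_inner_le_norm (K.starProjection (mask m (v - K.starProjection v))) d
  have h4 := hK d hdK
  rw [h1, h2] at h4
  rcases (norm_nonneg d).eq_or_lt with h | h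
  · rw [← h, mul_zero]; exact norm_nonneg _
  · refine le_of_mul_le_mul_right ?_ h
    linarith

/-- Pythagoras in the seminorm with weights `m`: the fitted vector has no more weighted energy than
the data. -/
theorem norm_sq_le_of_normal (hm : ∀ q, 0 ≤ m q)
    (hK : ∀ t ∈ K, lam * ‖t‖ ^ 2 ≤ ∑ q, m q * t q ^ 2) (hw : w ∈ K)
    (hnormal : ∀ t ∈ K, ∑ q, m q * (v q - w q) * t q = 0) :
    lam * ‖w‖ ^ 2 ≤ ∑ q, m q * v q ^ 2 := by
  have h1 : ∑ q, m q * w q ^ 2 + ∑ q, m q * (v q - w q) ^ 2 +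
      2 * ∑ q, m q * (v q - w q) * w q = ∑ q, m q * v q ^ 2 := by
    rw [Finset.mul_sum, ← Finset.sum_add_distrib, ← Finset.sum_add_distrib]
    exact Finset.sum_congr rfl fun q _ => by ring
  have h2 := hnormal w hw
  have h3 : 0 ≤ ∑ q, m q * (v q - w q) ^ 2 :=
    Finset.sum_nonneg fun q _ => mul_nonneg (hm q) (sq_nonneg _)
  have h4 := hK w hw
  linarith

end RowEstimates

/-! ### One mode update with a good sample -/

section ModeUpdate

variable {n r : ℕ}

/-- The rows of the first unfolding of `∑ i, σ i • (x i ⊗ y i ⊗ z i)`. -/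
noncomputable def unfoldRow (σ : Fin r → ℝ) (x y z : Fin r → EuclideanSpace ℝ (Fin n))
    (j : Fin n) : EuclideanSpace ℝ (Fin n × Fin n) :=
  ∑ i, (σ i * x i j) • outer (y i) (z i)

theorem unfoldRow_apply (σ : Fin r → ℝ) (x y z : Fin r → EuclideanSpace ℝ (Fin n))
    (j : Fin n) (q : Fin n × Fin n) :
    unfoldRow σ x y z j q = ∑ i, σ i * (x i j * y i q.1 * z i q.2) := by
  simp only [unfoldRow, WithLp.ofLp_sum, Finset.sum_apply, PiLp.smul_apply, outer_apply,
    smul_eq_mul]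
  exact Finset.sum_congr rfl fun i _ => by ring

theorem abs_unfoldRow_apply_le {σ : Fin r → ℝ} {x y z : Fin r → EuclideanSpace ℝ (Fin n)}
    {s g : ℝ} (hσ : ∀ i, 0 ≤ σ i) (hσs : ∀ i, σ i ≤ s) (hx : ∀ i j, |x i j| ≤ g)
    (hy : ∀ i j, |y i j| ≤ g) (hz : ∀ i j, |z i j| ≤ g) (j : Fin n) (q : Fin n × Fin n) :
    |unfoldRow σ x y z j q| ≤ r * s * g ^ 3 := by
  rw [unfoldRow_apply]
  refine (Finset.abs_sum_le_sum_abs _ _).trans ?_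
  refine (Finset.sum_le_card_nsmul Finset.univ _ (s * g ^ 3) fun i _ => ?_).trans
    (le_of_eq (by rw [nsmul_eq_mul, Finset.card_univ, Fintype.card_fin, mul_assoc]))
  rw [abs_mul, abs_mul, abs_mul, abs_of_nonneg (hσ i)]
  have h1 := hx i j
  have h2 := hy i q.1
  have h3 := hz i q.2
  have h4 := hσs i
  have hg : 0 ≤ g := (abs_nonneg _).trans h1
  have hs : 0 ≤ s := (hσ i).trans h4
  calc σ i * (|x i j| * |y i q.1| * |z i q.2|) ≤ s * (g * g * g) := by gcongr
    _ = _ := by ring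

theorem sum_norm_unfoldRow_sq_le {σ : Fin r → ℝ} {x y z : Fin r → EuclideanSpace ℝ (Fin n)}
    {s : ℝ} (hσ : ∀ i, 0 ≤ σ i) (hσs : ∀ i, σ i ≤ s) (hx : ∀ i, ‖x i‖ = 1)
    (hy : ∀ i, ‖y i‖ = 1) (hz : ∀ i, ‖z i‖ = 1) :
    ∑ j, ‖unfoldRow σ x y z j‖ ^ 2 ≤ (r * s) ^ 2 := by
  have h1 : ∀ j, ‖unfoldRow σ x y z j‖ ^ 2 ≤ r * ∑ i, s ^ 2 * x i j ^ 2 := by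
    intro j
    have h2 : ‖unfoldRow σ x y z j‖ ≤ ∑ i, s * |x i j| := by
      refine (norm_sum_le _ _).trans (Finset.sum_le_sum fun i _ => ?_)
      rw [norm_smul, norm_outer, hy, hz, norm_mul, Real.norm_of_nonneg (hσ i), Real.norm_eq_abs,
        one_mul, mul_one]
      have := hσs i
      gcongr
    calc ‖unfoldRow σ x y z j‖ ^ 2 ≤ (∑ i, s * |x i j|) ^ 2 := by gcongr
      _ ≤ (Finset.univ : Finset (Fin r)).card * ∑ i, (s * |x i j|) ^ 2 := sq_sum_le_card_mul_sum_sq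
      _ = _ := by simp [mul_pow]
  refine (Finset.sum_le_sum fun j _ => h1 j).trans (le_of_eq ?_)
  rw [← Finset.mul_sum, Finset.sum_comm]
  have h3 : ∀ i, ∑ j, s ^ 2 * x i j ^ 2 = s ^ 2 := by
    intro i
    have h4 := EuclideanSpace.norm_sq_eq (x i)
    rw [hx] at h4
    simp only [one_pow, Real.norm_eq_abs, sq_abs] at h4
    rw [← Finset.mul_sum, ← h4, mul_one]
  simp [h3]
  ring

theorem rowMap_unfoldRow (σ : Fin r → ℝ) (x y z : Fin r → EuclideanSpace ℝ (Fin n))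
    (a : EuclideanSpace ℝ (Fin n)) :
    rowMap (unfoldRow σ x y z) a = ∑ i, (σ i * inner ℝ (x i) a) • outer (y i) (z i) := by
  simp only [rowMap_apply, unfoldRow, Finset.smul_sum, smul_smul]
  rw [Finset.sum_comm]
  refine Finset.sum_congr rfl fun i _ => ?_
  rw [← Finset.sum_smul]
  congr 1
  simp only [PiLp.inner_apply, Finset.mul_sum]
  exact Finset.sum_congr rfl fun j _ => by simp; ring

theorem rowMap_starProjection (K : Submodule ℝ (EuclideanSpace ℝ (Fin n × Fin n)))
    (u : Fin n → EuclideanSpace ℝ (Fin n × Fin n)) (a : EuclideanSpace ℝ (Fin n)) :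
    rowMap (fun j => K.starProjection (u j)) a = K.starProjection (rowMap u a) := by
  simp [rowMap_apply, map_sum]

theorem half_norm_le_norm_starProjection_tensorSpace
    {V W : Submodule ℝ (EuclideanSpace ℝ (Fin n))}
    {y z : Fin r → EuclideanSpace ℝ (Fin n)} {α : ℝ} (hα : α ≤ 1 / 10)
    (hV : sinAngle (Submodule.span ℝ (Set.range y)) V ≤ α)
    (hW : sinAngle (Submodule.span ℝ (Set.range z)) W ≤ α) (d : Fin r → ℝ) :
    ‖∑ i, d i • outer (y i) (z i)‖ / 2 ≤
      ‖(tensorSpace V W).starProjection (∑ i, d i • outer (y i) (z i))‖ := by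
  have h1 := norm_sub_starProjection_tensorSpace_le hV hW d
  set t := ∑ i, d i • outer (y i) (z i)
  have h2 := norm_sub_norm_le t ((tensorSpace V W).starProjection t)
  nlinarith [norm_nonneg t]

/-- The smallest singular value of the projected unfolding is bounded below. -/
theorem le_norm_rowMap_starProjection_unfoldRow
    {V W : Submodule ℝ (EuclideanSpace ℝ (Fin n))} {σ : Fin r → ℝ}
    {x y z : Fin r → EuclideanSpace ℝ (Fin n)} {α c s : ℝ} (hα : α ≤ 1 / 10) (hc : 0 ≤ c)
    (hs : 0 ≤ s) (hσs : ∀ i, s ≤ σ i)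
    (hV : sinAngle (Submodule.span ℝ (Set.range y)) V ≤ α)
    (hW : sinAngle (Submodule.span ℝ (Set.range z)) W ≤ α)
    (hx : ∀ d : EuclideanSpace ℝ (Fin r), c * ‖d‖ ≤ ‖∑ i, d i • x i‖)
    (hy : ∀ d : EuclideanSpace ℝ (Fin r), c * ‖d‖ ≤ ‖∑ i, d i • y i‖) (hz : ∀ i, ‖z i‖ = 1)
    {a : EuclideanSpace ℝ (Fin n)} (ha : a ∈ Submodule.span ℝ (Set.range x)) :
    c ^ 2 * s / 2 * ‖a‖ ≤
      ‖rowMap (fun j => (tensorSpace V W).starProjection (unfoldRow σ x y z j)) a‖ := by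
  rw [rowMap_starProjection, rowMap_unfoldRow]
  refine le_trans ?_ (half_norm_le_norm_starProjection_tensorSpace hα hV hW _)
  have h1 := mul_norm_le_norm_inner_of_mem_span hx ha
  have h2 := le_norm_sum_outer hc hy hz (WithLp.toLp 2 fun i => σ i * inner ℝ (x i) a)
  have h3 : s * ‖(WithLp.toLp 2 fun i => inner ℝ (x i) a : EuclideanSpace ℝ (Fin r))‖ ≤
      ‖(WithLp.toLp 2 fun i => σ i * inner ℝ (x i) a : EuclideanSpace ℝ (Fin r))‖ := by
    refine le_of_sq_le_sq ?_ (norm_nonneg _)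
    rw [mul_pow, EuclideanSpace.norm_sq_eq, EuclideanSpace.norm_sq_eq, Finset.mul_sum]
    refine Finset.sum_le_sum fun i _ => ?_
    simp only [Real.norm_eq_abs, sq_abs, mul_pow]
    have := hσs i
    gcongr
  -- One factor c comes from x (inner products with a), s from the weights σ_i, the other c from y
  -- (independence of the y_i ⊗ z_i).
  have h4 : c * (s * (c * ‖a‖)) ≤
      ‖∑ i, (σ i * inner ℝ (x i) a) • outer (y i) (z i)‖ := by
    refine le_trans ?_ h2
    refine mul_le_mul_of_nonneg_left (le_trans ?_ h3) hc
    exact mul_le_mul_of_nonneg_left h1 hs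
  linarith

theorem rowMap_starProjection_unfoldRow_eq_zero
    (K : Submodule ℝ (EuclideanSpace ℝ (Fin n × Fin n))) {σ : Fin r → ℝ}
    {x y z : Fin r → EuclideanSpace ℝ (Fin n)} {a : EuclideanSpace ℝ (Fin n)}
    (ha : a ∈ (Submodule.span ℝ (Set.range x))ᗮ) :
    rowMap (fun j => K.starProjection (unfoldRow σ x y z j)) a = 0 := by
  rw [rowMap_starProjection, rowMap_unfoldRow]
  have : ∀ i, inner ℝ (x i) a = 0 := fun i =>
    (Submodule.mem_orthogonal _ _).1 ha _ (Submodule.subset_span (Set.mem_range_self i))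
  simp [this]

/-- The properties of a sample of the entries with rate `p` that make the update of a mode work. -/
structure GoodSample (S : Set (Entry n)) (entry : Fin n → Fin n × Fin n → Entry n)
    (K : Submodule ℝ (EuclideanSpace ℝ (Fin n × Fin n)))
    (U : Fin n → EuclideanSpace ℝ (Fin n × Fin n)) (p η : ℝ) : Prop where
  lower : ∀ j, ∀ t ∈ K, p / 2 * ‖t‖ ^ 2 ≤ ∑ q, obs S (entry j q) * t q ^ 2
  card : ∀ j, ∑ q, obs S (entry j q) ≤ 2 * p * n ^ 2
  noise : ∑ j, ‖K.starProjection
    (mask (fun q => obs S (entry j q)) (U j - K.starProjection (U j)))‖ ^ 2 ≤ (p / 2 * η) ^ 2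

/-- The update of a mode with a good sample improves the angle and keeps the estimate
incoherent. -/
theorem IsModeUpdate.sinAngle_le_and_isIncoherent {T : Entry n → ℝ} {S : Set (Entry n)}
    {entry : Fin n → Fin n × Fin n → Entry n}
    {V W V' : Submodule ℝ (EuclideanSpace ℝ (Fin n))} {σ : Fin r → ℝ}
    {x y z : Fin r → EuclideanSpace ℝ (Fin n)} {α c s₁ s g μ' p : ℝ} (hr : 0 < r)
    (hupd : IsModeUpdate r T S entry V W V')
    (hT : ∀ j q, T (entry j q) = unfoldRow σ x y z j q)
    (hα0 : 0 ≤ α) (hα : α ≤ 1 / 10) (hc : 0 < c) (hs : 0 < s) (hσs : ∀ i, s ≤ σ i)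
    (hσs₁ : ∀ i, σ i ≤ s₁)
    (hV : sinAngle (Submodule.span ℝ (Set.range y)) V ≤ α)
    (hW : sinAngle (Submodule.span ℝ (Set.range z)) W ≤ α)
    (hx : ∀ d : EuclideanSpace ℝ (Fin r), c * ‖d‖ ≤ ‖∑ i, d i • x i‖)
    (hy : ∀ d : EuclideanSpace ℝ (Fin r), c * ‖d‖ ≤ ‖∑ i, d i • y i‖) (hz : ∀ i, ‖z i‖ = 1)
    (hgx : ∀ i j, |x i j| ≤ g) (hgy : ∀ i j, |y i j| ≤ g) (hgz : ∀ i j, |z i j| ≤ g)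
    (hμ' : 8 * n * r * s₁ * g ^ 3 / (c ^ 2 * s) ≤ √(μ' * r / n)) (hp : 0 < p)
    (hS : GoodSample S entry (tensorSpace V W) (unfoldRow σ x y z) p (c ^ 2 * s * α / 20)) :
    sinAngle (Submodule.span ℝ (Set.range x)) V' ≤ 0.2 * α ∧ IsIncoherent μ' V' := by
  obtain ⟨B, H, ⟨hB, hBK⟩, hmin, hV'⟩ := hupd
  have hfin := finrank_of_isTopLeftSingularSpace hV'
  obtain ⟨hrn, u, sv, hsv, hsv0, heig, rfl⟩ := hV'
  set K := tensorSpace V W with hK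
  set U := unfoldRow σ x y z with hU
  set w : Fin n → EuclideanSpace ℝ (Fin n × Fin n) := fun j => rowVec B (H j) with hw
  have hwK : ∀ h, rowVec B h ∈ K := by
    intro h
    rw [← hBK]
    exact Submodule.sum_mem _ fun l _ => Submodule.smul_mem _ _
      (Submodule.subset_span (Set.mem_range_self l))
  have hmin' : ∀ H' : Matrix (Fin n) (Fin (r ^ 2)) ℝ,
      observedLoss (Matrix.of fun j q => U j q) {q | entry q.1 q.2 ∈ S} B H ≤
        observedLoss (Matrix.of fun j q => U j q) {q | entry q.1 q.2 ∈ S} B H' := by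
    have : (fun j q => T (entry j q)) = fun j q => U j q := by
      ext j q
      exact hT j q
    rw [this] at hmin
    exact hmin
  have hnormal : ∀ j, ∀ t ∈ K, ∑ q, obs S (entry j q) * (U j q - w j q) * t q = 0 := by
    intro j t ht
    rw [← hBK] at ht
    obtain ⟨h, rfl⟩ := (Submodule.mem_span_range_iff_exists_fun ℝ).1 ht
    exact sum_obs_mul_eq_zero_of_isMin hmin' j h
  have hΦ : ∀ a, ‖rowMap w a‖ ^ 2 = ∑ i, sv i ^ 2 * inner ℝ (u i) a ^ 2 := fun a => by
    rw [norm_rowMap_rowVec_sq hB, inner_apply_eq_sum_of_eigenbasis u heig]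
  set Ψ : EuclideanSpace ℝ (Fin n) →ₗ[ℝ] EuclideanSpace ℝ (Fin n × Fin n) :=
    rowMap (fun j => K.starProjection (U j)) with hΨ
  set c₀ := c ^ 2 * s with hc₀
  have hc₀pos : 0 < c₀ := by positivity
  have hΨ0 : ∀ a ∈ (Submodule.span ℝ (Set.range x))ᗮ, Ψ a = 0 := fun a ha =>
    rowMap_starProjection_unfoldRow_eq_zero K ha
  have hΨlow : ∀ a ∈ Submodule.span ℝ (Set.range x), c₀ / 2 * ‖a‖ ≤ ‖Ψ a‖ := fun a ha =>
    le_norm_rowMap_starProjection_unfoldRow hα hc.le hs.le hσs hV hW hx hy hz ha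
  have hε0 : 0 ≤ c₀ * α / 20 := by positivity
  have hε : ∀ a, ‖rowMap w a - Ψ a‖ ≤ c₀ * α / 20 * ‖a‖ := by
    refine norm_rowMap_sub_le hε0 ?_
    have h1 : ∑ j, (p / 2 * ‖w j - K.starProjection (U j)‖) ^ 2 ≤ (p / 2 * (c₀ * α / 20)) ^ 2 := by
      refine (Finset.sum_le_sum fun j _ => ?_).trans hS.noise
      have := norm_sub_starProjection_le_of_normal (hS.lower j) (hwK (H j)) (hnormal j)
      gcongr
    simp only [mul_pow, ← Finset.mul_sum] at h1
    have h2 := le_of_mul_le_mul_left h1 (by positivity)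
    simpa only [mul_pow] using h2
  have hUfin : Module.finrank ℝ (Submodule.span ℝ (Set.range x)) = r := by
    rw [finrank_span_eq_card (linearIndependent_of_lower_bound hc hx), Fintype.card_fin]
  refine ⟨sinAngle_le (by positivity) fun v hv => ?_, fun j => ?_⟩
  -- With error c₀α/20 and lower bound c₀/2, the constant 2ε/S is α/5.
  · refine (norm_starProjection_orthogonal_topSpace_le hsv hsv0 hΦ (half_pos hc₀pos) hΨ0 hΨlow hε
      hε0 hUfin.le hv).trans (le_of_eq ?_)
    congr 1
    field_simp
    ring
  · rw [hfin]
    set m : Fin n := ⟨r - 1, by omega⟩ with hm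
    have h1 := sub_le_singularValue hsv hsv0 hΦ hΨlow hε m (by rw [hUfin]; simp [m]; omega)
    -- As α ≤ 1/10, c₀/2 − c₀α/20 is well above c₀/4.
    have h2 : c₀ / 4 ≤ sv m := by nlinarith
    have h3 := singularValue_mul_norm_starProjection_topSpace_le hsv hsv0 hΦ m
      (EuclideanSpace.single j 1)
    have hmr : (m : ℕ) + 1 = r := by simp [m]; omega
    rw [hmr, rowMap_single] at h3
    have hs₁ : 0 ≤ s₁ := (hs.le.trans (hσs ⟨0, hr⟩)).trans (hσs₁ ⟨0, hr⟩)
    have hg : 0 ≤ g := (abs_nonneg _).trans (hgx ⟨0, hr⟩ j)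
    have h4 : ‖w j‖ ≤ 2 * n * (r * s₁ * g ^ 3) := by
      have h5 := norm_sq_le_of_normal (fun q => obs_nonneg S (entry j q)) (hS.lower j) (hwK (H j))
        (hnormal j)
      have h6 : ∑ q, obs S (entry j q) * U j q ^ 2 ≤
          2 * p * n ^ 2 * (r * s₁ * g ^ 3) ^ 2 := by
        refine le_trans ?_ (mul_le_mul_of_nonneg_right (hS.card j) (sq_nonneg (r * s₁ * g ^ 3)))
        rw [Finset.sum_mul]
        refine Finset.sum_le_sum fun q _ => mul_le_mul_of_nonneg_left ?_ (obs_nonneg _ _)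
        rw [← sq_abs]
        have := abs_unfoldRow_apply_le (fun i => hs.le.trans (hσs i)) hσs₁ hgx hgy hgz j q
        gcongr
      refine le_of_sq_le_sq ?_ (by positivity)
      -- The sampling rate cancels: about pn² observed entries feed the data, and the lower bound on
      -- K is p/2.
      have h7 : p / 2 * ‖w j‖ ^ 2 ≤ p / 2 * (2 * n * (r * s₁ * g ^ 3)) ^ 2 := by
        refine (h5.trans h6).trans (le_of_eq ?_)
        ring
      exact le_of_mul_le_mul_left h7 (half_pos hp)
    change ‖(Submodule.span ℝ (u '' {i | (i : ℕ) < r})).starProjection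
      (EuclideanSpace.single j 1)‖ ≤ _
    refine le_trans ?_ hμ'
    rw [le_div_iff₀ hc₀pos]
    have h8 := mul_le_mul_of_nonneg_right h2 (norm_nonneg
      ((Submodule.span ℝ (u '' {i | (i : ℕ) < r})).starProjection (EuclideanSpace.single j 1)))
    linarith

end ModeUpdate

/-! ### Coordinates in an orthonormal basis of a subspace -/

section Subspace

variable {κ ι : Type*} [Fintype κ] [Fintype ι] {K : Submodule ℝ (EuclideanSpace ℝ κ)}
  (b : OrthonormalBasis ι ℝ K)

theorem norm_starProjection_sq_eq_sum (v : EuclideanSpace ℝ κ) :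
    ‖K.starProjection v‖ ^ 2 = ∑ l, inner ℝ (b l : EuclideanSpace ℝ κ) v ^ 2 := by
  rw [Submodule.starProjection_apply, ← Submodule.coe_norm, ← b.sum_sq_norm_inner_right]
  refine Finset.sum_congr rfl fun l _ => ?_
  rw [Submodule.inner_orthogonalProjectionOnto_eq_of_mem_left]
  simp

open Classical in
theorem sum_basis_apply_sq_le {γ : ℝ}
    (hγ : ∀ q : κ, ‖K.starProjection (EuclideanSpace.single q 1)‖ ≤ γ) (q : κ) :
    ∑ l, (b l : EuclideanSpace ℝ κ) q ^ 2 ≤ γ ^ 2 := by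
  have h1 := norm_starProjection_sq_eq_sum b (EuclideanSpace.single q 1)
  simp only [EuclideanSpace.inner_single_right, one_mul, conj_trivial] at h1
  rw [← h1]
  have := hγ q
  gcongr

open Classical in
theorem abs_basis_apply_le {γ : ℝ} (hγ0 : 0 ≤ γ)
    (hγ : ∀ q : κ, ‖K.starProjection (EuclideanSpace.single q 1)‖ ≤ γ) (l : ι) (q : κ) :
    |(b l : EuclideanSpace ℝ κ) q| ≤ γ := by
  refine abs_le_of_sq_le_sq ((Finset.single_le_sum (fun l _ =>
    sq_nonneg ((b l : EuclideanSpace ℝ κ) q))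
    (Finset.mem_univ l)).trans (sum_basis_apply_sq_le b hγ q)) hγ0

theorem sum_basis_apply_sq_eq_one (l : ι) : ∑ q, (b l : EuclideanSpace ℝ κ) q ^ 2 = 1 := by
  have h1 := EuclideanSpace.norm_sq_eq (b l : EuclideanSpace ℝ κ)
  rw [← Submodule.coe_norm, b.norm_eq_one] at h1
  simpa using h1.symm

/-- A weighted Gram matrix that is entrywise close to a multiple of the identity is bounded
below. -/
theorem half_mul_norm_sq_le_of_gram_close {m : κ → ℝ} {p : ℝ}
    (h : ∀ l l', |∑ q, (m q - p) * ((b l : EuclideanSpace ℝ κ) q * (b l' : EuclideanSpace ℝ κ) q)| ≤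
      p / (2 * Fintype.card ι)) {t : EuclideanSpace ℝ κ} (ht : t ∈ K) :
    p / 2 * ‖t‖ ^ 2 ≤ ∑ q, m q * t q ^ 2 := by
  rcases isEmpty_or_nonempty ι with hι | ⟨⟨l₀⟩⟩
  · have h1 : (⟨t, ht⟩ : K) = 0 := by
      rw [← b.sum_repr ⟨t, ht⟩]; simp
    have h2 : t = 0 := congrArg Subtype.val h1
    simp [h2]
  have hN : (0 : ℝ) < Fintype.card ι := by exact_mod_cast Fintype.card_pos_iff.2 ⟨l₀⟩
  have hp : 0 ≤ p := by
    by_contra hp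
    have := (abs_nonneg _).trans (h l₀ l₀)
    exact absurd this (not_le.2 (div_neg_of_neg_of_pos (not_le.1 hp) (by positivity)))
  set d : ι → ℝ := fun l => b.repr ⟨t, ht⟩ l with hd
  have htd : t = ∑ l, d l • (b l : EuclideanSpace ℝ κ) := by
    have := congrArg Subtype.val (b.sum_repr ⟨t, ht⟩)
    simpa using this.symm
  have hnorm : ‖t‖ ^ 2 = ∑ l, d l ^ 2 := by
    have h1 : ‖t‖ = ‖b.repr ⟨t, ht⟩‖ := by rw [b.repr.norm_map]; rfl
    rw [h1, EuclideanSpace.norm_sq_eq]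
    simp [d]
  have h2 : ∑ q, (m q - p) * t q ^ 2 = ∑ l, ∑ l', d l * d l' *
      ∑ q, (m q - p) * ((b l : EuclideanSpace ℝ κ) q * (b l' : EuclideanSpace ℝ κ) q) := by
    simp only [Finset.mul_sum]
    have h3 : ∀ q, (m q - p) * t q ^ 2 = ∑ l, ∑ l', d l * d l' *
        ((m q - p) * ((b l : EuclideanSpace ℝ κ) q * (b l' : EuclideanSpace ℝ κ) q)) := by
      intro q
      rw [htd, sq]
      simp only [WithLp.ofLp_sum, Finset.sum_apply, PiLp.smul_apply, smul_eq_mul]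
      rw [Finset.sum_mul_sum, Finset.mul_sum]
      refine Finset.sum_congr rfl fun l _ => ?_
      rw [Finset.mul_sum]
      exact Finset.sum_congr rfl fun l' _ => by ring
    simp_rw [h3]
    rw [Finset.sum_comm]
    refine Finset.sum_congr rfl fun l _ => ?_
    rw [Finset.sum_comm]
  have h4 : |∑ q, (m q - p) * t q ^ 2| ≤ p / 2 * ‖t‖ ^ 2 := by
    rw [h2]
    -- A matrix of size N with entries at most p/(2N) has operator norm at most p/2.
    calc _ ≤ ∑ l, ∑ l', |d l| * |d l'| * (p / (2 * Fintype.card ι)) := by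
          refine (Finset.abs_sum_le_sum_abs _ _).trans (Finset.sum_le_sum fun l _ => ?_)
          refine (Finset.abs_sum_le_sum_abs _ _).trans (Finset.sum_le_sum fun l' _ => ?_)
          rw [abs_mul, abs_mul]
          have := h l l'
          gcongr
      _ = (∑ l, |d l|) ^ 2 * (p / (2 * Fintype.card ι)) := by
          rw [sq, Finset.sum_mul_sum, Finset.sum_mul]
          simp only [Finset.sum_mul]
      _ ≤ (Fintype.card ι * ∑ l, |d l| ^ 2) * (p / (2 * Fintype.card ι)) := by
          gcongr
          exact sq_sum_le_card_mul_sum_sq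
      _ = _ := by
          rw [hnorm]
          simp only [sq_abs]
          field_simp
  have h5 : ∑ q, (m q - p) * t q ^ 2 = ∑ q, m q * t q ^ 2 - p * ‖t‖ ^ 2 := by
    rw [EuclideanSpace.norm_sq_eq, Finset.mul_sum, ← Finset.sum_sub_distrib]
    exact Finset.sum_congr rfl fun q _ => by simp; ring
  rw [h5] at h4
  linarith [neg_le_of_abs_le h4]

end Subspace

/-! ### Random samples are good with high probability -/

section Sampling

variable {n : ℕ} {ι : Type*} [Fintype ι]
  {K : Submodule ℝ (EuclideanSpace ℝ (Fin n × Fin n))}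
  {entry : Fin n → Fin n × Fin n → Entry n}

/-- The second moment of the noise in one row. -/
theorem integral_norm_starProjection_mask_sq_le (b : OrthonormalBasis ι ℝ K) (p : unitInterval)
    {γ : ℝ} (hγ : ∀ q, ‖K.starProjection (EuclideanSpace.single q 1)‖ ≤ γ) {j : Fin n}
    (hentry : (entry j).Injective) {e : EuclideanSpace ℝ (Fin n × Fin n)} (he : e ∈ Kᗮ) :
    ∫ S, ‖K.starProjection (mask (fun q => obs S (entry j q)) e)‖ ^ 2
      ∂(setBernoulli (Set.univ : Set (Entry n)) p) ≤ p * γ ^ 2 * ‖e‖ ^ 2 := by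
  -- As e is orthogonal to K, replacing the indicator by its centred version changes nothing. The
  -- noise has mean zero and only its variance matters.
  have h1 : ∀ (S : Set (Entry n)) (l : ι),
      inner ℝ (b l : EuclideanSpace ℝ (Fin n × Fin n)) (mask (fun q => obs S (entry j q)) e) =
        ∑ q, (obs S (entry j q) - p) * (e q * (b l : EuclideanSpace ℝ (Fin n × Fin n)) q) := by
    intro S l
    have h2 : inner ℝ e (b l : EuclideanSpace ℝ (Fin n × Fin n)) = 0 :=
      Submodule.inner_left_of_mem_orthogonal (b l).2 he
    have h3 : ∑ q, e q * (b l : EuclideanSpace ℝ (Fin n × Fin n)) q = 0 := by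
      rw [← h2, PiLp.inner_apply]
      exact Finset.sum_congr rfl fun q _ => by simp; ring
    rw [real_inner_comm, inner_mask]
    simp only [sub_mul, Finset.sum_sub_distrib, ← Finset.mul_sum, h3, mul_zero, sub_zero]
    exact Finset.sum_congr rfl fun q _ => by ring
  simp_rw [norm_starProjection_sq_eq_sum b, h1]
  rw [integral_finsetSum _ fun _ _ => Integrable.of_finite]
  simp_rw [integral_sum_obs_sub_sq p hentry]
  rw [← Finset.mul_sum, Finset.sum_comm]
  have hp0 := p.2.1
  have hp1 := p.2.2
  have h4 : ∑ q, ∑ l, (e q * (b l : EuclideanSpace ℝ (Fin n × Fin n)) q) ^ 2 ≤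
      γ ^ 2 * ‖e‖ ^ 2 := by
    rw [EuclideanSpace.norm_sq_eq, Finset.mul_sum]
    refine Finset.sum_le_sum fun q _ => ?_
    simp only [mul_pow, ← Finset.mul_sum, Real.norm_eq_abs, sq_abs]
    rw [mul_comm]
    refine mul_le_mul_of_nonneg_right ?_ (sq_nonneg _)
    refine sum_basis_apply_sq_le b (fun q => ?_) q
    convert hγ q
  have h5 : 0 ≤ ∑ q, ∑ l, (e q * (b l : EuclideanSpace ℝ (Fin n × Fin n)) q) ^ 2 := by positivity
  calc (p : ℝ) * (1 - p) * ∑ q, ∑ l, (e q * (b l : EuclideanSpace ℝ (Fin n × Fin n)) q) ^ 2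
      ≤ p * 1 * (γ ^ 2 * ‖e‖ ^ 2) := by gcongr; linarith
    _ = _ := by ring

/-- The products of two basis coordinates are at most γ² and their squares sum to at most γ², so
Bernstein applies with β = γ², D = 1. Working entry by entry needs accuracy 1/N, hence ε = 1/(4N)
and the factor N² in the exponent. -/
theorem measureReal_gram_far_le (b : OrthonormalBasis ι ℝ K) (p : unitInterval)
    {γ : ℝ} (hγ0 : 0 < γ) (hγ : ∀ q, ‖K.starProjection (EuclideanSpace.single q 1)‖ ≤ γ)
    {j : Fin n} (hentry : (entry j).Injective) (l l' : ι) :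
    (setBernoulli (Set.univ : Set (Entry n)) p).real
      {S | (p : ℝ) / (2 * Fintype.card ι) ≤ |∑ q, (obs S (entry j q) - p) *
        ((b l : EuclideanSpace ℝ (Fin n × Fin n)) q *
          (b l' : EuclideanSpace ℝ (Fin n × Fin n)) q)|} ≤
      2 * Real.exp (-(p / (16 * (Fintype.card ι) ^ 2 * γ ^ 2))) := by
  have hN : (1 : ℝ) ≤ Fintype.card ι := by exact_mod_cast Fintype.card_pos_iff.2 ⟨l⟩
  have hb : ∀ l q, |(b l : EuclideanSpace ℝ (Fin n × Fin n)) q| ≤ γ := fun l q =>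
    abs_basis_apply_le b hγ0.le (fun q => by convert hγ q) l q
  have h1 := measureReal_abs_sum_obs_ge_le p hentry
    (fun q => (b l : EuclideanSpace ℝ (Fin n × Fin n)) q *
      (b l' : EuclideanSpace ℝ (Fin n × Fin n)) q) (β := γ ^ 2) (D := 1)
    (ε := 1 / (4 * Fintype.card ι)) (by positivity) (fun q => by
      rw [abs_mul, sq]
      exact mul_le_mul (hb l q) (hb l' q) (abs_nonneg _) hγ0.le) (by
      rw [← sum_basis_apply_sq_eq_one b l', Finset.mul_sum]
      refine Finset.sum_le_sum fun q _ => ?_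
      rw [mul_pow]
      refine mul_le_mul_of_nonneg_right ?_ (sq_nonneg _)
      rw [← sq_abs]
      have := hb l q
      gcongr) (by positivity) (by rw [div_le_one (by positivity)]; linarith)
  have h2 : 2 * (1 / (4 * (Fintype.card ι : ℝ))) * p * 1 = p / (2 * Fintype.card ι) := by
    field_simp; ring
  have h3 : (1 / (4 * (Fintype.card ι : ℝ))) ^ 2 * p * 1 / γ ^ 2 =
    p / (16 * (Fintype.card ι) ^ 2 * γ ^ 2) := by
    field_simp; ring
  rwa [h2, h3] at h1

theorem measureReal_card_large_le (p : unitInterval) {j : Fin n} (hentry : (entry j).Injective) :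
    (setBernoulli (Set.univ : Set (Entry n)) p).real
      {S | 2 * (p : ℝ) * n ^ 2 < ∑ q, obs S (entry j q)} ≤ Real.exp (-(p * n ^ 2 / 4)) := by
  have hcard : ((Finset.univ : Finset (Fin n × Fin n)).card : ℝ) = n ^ 2 := by
    simp [sq]
  have h1 := measureReal_sum_obs_ge_le p hentry (fun _ => (1 : ℝ)) (β := 1) (D := n ^ 2)
    (ε := 1 / 2) one_pos (by simp) (by
      simp only [one_pow, Finset.sum_const, nsmul_eq_mul, hcard, mul_one, one_mul]
      exact le_rfl) (by norm_num) (by norm_num)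
  have h2 : (1 / 2 : ℝ) ^ 2 * p * n ^ 2 / 1 = p * n ^ 2 / 4 := by ring
  rw [h2] at h1
  refine le_trans (measureReal_mono fun S hS => ?_) h1
  simp only [Set.mem_ofPred_eq, mul_one, Finset.sum_sub_distrib, Finset.sum_const, nsmul_eq_mul,
    hcard] at hS ⊢
  linarith

/-- Most samples are good. -/
theorem measureReal_not_goodSample_le (b : OrthonormalBasis ι ℝ K) (p : unitInterval)
    {γ : ℝ} (hγ0 : 0 < γ) (hγ : ∀ q, ‖K.starProjection (EuclideanSpace.single q 1)‖ ≤ γ)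
    (hentry : ∀ j, (entry j).Injective) {U : Fin n → EuclideanSpace ℝ (Fin n × Fin n)}
    {D C η : ℝ} (hD : ∑ j, ‖U j - K.starProjection (U j)‖ ^ 2 ≤ D) (hC : 0 < C)
    (hη : C * (p * γ ^ 2 * D) ≤ (p / 2 * η) ^ 2) :
    (setBernoulli (Set.univ : Set (Entry n)) p).real {S | ¬ GoodSample S entry K U p η} ≤
      n * (Fintype.card ι) ^ 2 * (2 * Real.exp (-(p / (16 * (Fintype.card ι) ^ 2 * γ ^ 2)))) +
        n * Real.exp (-(p * n ^ 2 / 4)) + C⁻¹ := by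
  set P := setBernoulli (Set.univ : Set (Entry n)) p
  have hp0 := p.2.1
  set E₁ : Fin n × ι × ι → Set (Set (Entry n)) := fun i =>
    {S | (p : ℝ) / (2 * Fintype.card ι) ≤ |∑ q, (obs S (entry i.1 q) - p) *
        ((b i.2.1 : EuclideanSpace ℝ (Fin n × Fin n)) q *
          (b i.2.2 : EuclideanSpace ℝ (Fin n × Fin n)) q)|} with hE₁
  set E₂ : Fin n → Set (Set (Entry n)) := fun j =>
    {S | 2 * (p : ℝ) * n ^ 2 < ∑ q, obs S (entry j q)} with hE₂
  set f : Set (Entry n) → ℝ := fun S => ∑ j, ‖K.starProjection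
    (mask (fun q => obs S (entry j q)) (U j - K.starProjection (U j)))‖ ^ 2 with hf
  set E₃ : Set (Set (Entry n)) := {S | C * (p * γ ^ 2 * D) < f S} with hE₃
  have hsub : {S | ¬ GoodSample S entry K U p η} ⊆ ((⋃ i, E₁ i) ∪ ⋃ j, E₂ j) ∪ E₃ := by
    intro S hS
    by_contra hcon
    simp only [Set.mem_union, Set.mem_iUnion, not_or, not_exists] at hcon
    obtain ⟨⟨h1, h2⟩, h3⟩ := hcon
    refine hS ⟨fun j t ht => ?_, fun j => ?_, ?_⟩
    · refine half_mul_norm_sq_le_of_gram_close b (fun l l' => ?_) ht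
      have := h1 (j, l, l')
      simp only [hE₁, Set.mem_ofPred_eq, not_le] at this
      exact this.le
    · have := h2 j
      simpa only [hE₂, Set.mem_ofPred_eq, not_lt] using this
    · simp only [hE₃, Set.mem_ofPred_eq, not_lt] at h3
      exact h3.trans hη
  refine (measureReal_mono hsub).trans ?_
  refine (measureReal_union_le _ _).trans (add_le_add ((measureReal_union_le _ _).trans
    (add_le_add ?_ ?_)) ?_)
  · refine (measureReal_iUnion_fintype_le _).trans ?_
    refine (Finset.sum_le_card_nsmul Finset.univ _ _ fun i _ =>
      measureReal_gram_far_le b p hγ0 hγ (hentry i.1) i.2.1 i.2.2).trans (le_of_eq ?_)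
    rw [nsmul_eq_mul]
    simp [sq]
  · refine (measureReal_iUnion_fintype_le _).trans ?_
    refine (Finset.sum_le_card_nsmul Finset.univ _ _ fun j _ =>
      measureReal_card_large_le p (hentry j)).trans (le_of_eq ?_)
    rw [nsmul_eq_mul]
    simp
  · have hD0 : 0 ≤ D := le_trans (Finset.sum_nonneg fun j _ => sq_nonneg _) hD
    refine measureReal_mul_lt_le_inv (fun S => Finset.sum_nonneg fun j _ => sq_nonneg _)
      Integrable.of_finite (by positivity) ?_ hC
    rw [integral_finsetSum _ fun _ _ => Integrable.of_finite]
    refine (Finset.sum_le_sum fun j _ => integral_norm_starProjection_mask_sq_le b p hγ (hentry j)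
      (Submodule.sub_starProjection_mem_orthogonal (U j))).trans ?_
    rw [← Finset.mul_sum]
    gcongr

end Sampling

/-! ### Numerical estimates for the constants -/

section Numerics

/-- The left side is the incoherence parameter that one update actually produces. All of r, μ, κ,
1/c are at least 1, so larger exponents dominate, and 64 ≤ 2¹⁰. -/
theorem incoherence_constant_le {c μ r κ : ℝ} (hc : 0 < c) (hc1 : c ≤ 1) (hμ : 1 ≤ μ)
    (hr : 1 ≤ r) (hκ : 1 ≤ κ) :
    64 * r ^ 4 * μ ^ 3 * κ ^ 2 / c ^ 4 ≤ (2 * μ * r / c ^ 2 * κ ^ 2) ^ 10 := by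
  have hw : 1 ≤ c⁻¹ := (one_le_inv₀ hc).2 hc1
  have h1 : 64 * r ^ 4 * μ ^ 3 * κ ^ 2 / c ^ 4 = 64 * (r ^ 4 * μ ^ 3 * κ ^ 2 * c⁻¹ ^ 4) := by
    field_simp
  have h2 : (2 * μ * r / c ^ 2 * κ ^ 2) ^ 10 =
      1024 * (r ^ 10 * μ ^ 10 * κ ^ 20 * c⁻¹ ^ 20) := by
    field_simp
    norm_num
  rw [h1, h2]
  have h3 : r ^ 4 * μ ^ 3 * κ ^ 2 * c⁻¹ ^ 4 ≤ r ^ 10 * μ ^ 10 * κ ^ 20 * c⁻¹ ^ 20 := by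
    gcongr <;> first | assumption | norm_num
  have h4 : 0 ≤ r ^ 10 * μ ^ 10 * κ ^ 20 * c⁻¹ ^ 20 := by positivity
  linarith

theorem two_pow_ten_le_incoherence {c μ r κ : ℝ} (hc : 0 < c) (hc1 : c ≤ 1) (hμ : 1 ≤ μ)
    (hr : 1 ≤ r) (hκ : 1 ≤ κ) : 1024 ≤ (2 * μ * r / c ^ 2 * κ ^ 2) ^ 10 := by
  have hw : 1 ≤ c⁻¹ := (one_le_inv₀ hc).2 hc1
  have h1 : 2 * μ * r / c ^ 2 * κ ^ 2 = 2 * (μ * r * κ ^ 2 * c⁻¹ ^ 2) := by field_simp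
  have h2 : 1 ≤ μ * r * κ ^ 2 * c⁻¹ ^ 2 := by
    have h3 := one_le_pow₀ hκ (n := 2)
    have h4 := one_le_pow₀ hw (n := 2)
    exact one_le_mul_of_one_le_of_one_le (one_le_mul_of_one_le_of_one_le
      (one_le_mul_of_one_le_of_one_le hμ hr) h3) h4
  have h5 : (2 : ℝ) ≤ 2 * μ * r / c ^ 2 * κ ^ 2 := by rw [h1]; linarith
  calc (1024 : ℝ) = 2 ^ 10 := by norm_num
    _ ≤ _ := by gcongr

/-- The factor 3 exp(5L) accounts for the union bounds, whose sizes 2nr⁴ and n are at most 2n⁵ and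
n⁵. -/
theorem exp_neg_le_inv {L : ℝ} (hL : 1 ≤ L) :
    3 * (Real.exp (5 * L) * Real.exp (-(10 ^ 4 * L))) ≤ 1 / (10 ^ 5 * L) := by
  have h1 : Real.exp (5 * L) * Real.exp (-(10 ^ 4 * L)) ≤ (Real.exp (9000 * L))⁻¹ := by
    rw [← Real.exp_add, ← Real.exp_neg]
    apply Real.exp_le_exp.2
    linarith
  have h2 := Real.quadratic_le_exp_of_nonneg (x := 9000 * L) (by linarith)
  have h3 : 3 * 10 ^ 5 * L ≤ Real.exp (9000 * L) := by nlinarith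
  calc _ ≤ 3 * (Real.exp (9000 * L))⁻¹ := by gcongr
    _ ≤ 3 * (3 * 10 ^ 5 * L)⁻¹ := by gcongr
    _ = _ := by field_simp

/-- The left side is the failure probability in Markov's inequality. The four lower bounds on q,
each squared, use up q⁸: they pay for r², κ², c⁻⁴ and the numerical constant. -/
theorem noise_term_le {c r κ L p γ q : ℝ} (hc : 0 < c) (hr : 0 < r) (hκ : 0 < κ) (hL : 1 ≤ L)
    (hγ : 0 < γ) (hp : 0 < p) (hq2 : 10 * r ≤ q) (hq3 : 10 * (κ * c⁻¹) ≤ q) (hq4 : 10 * c⁻¹ ≤ q)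
    (hq5 : 10 ^ 4 ≤ q) (hpγ : 100 * L ^ 2 * q ^ 8 * γ ^ 2 ≤ p) :
    (p * c ^ 4 / (6400 * γ ^ 2 * r ^ 2 * κ ^ 2))⁻¹ ≤ 1 / (10 ^ 5 * L) := by
  rw [inv_div, div_le_div_iff₀ (by positivity) (by positivity), one_mul]
  have h1 : (10 * r) ^ 2 * (10 * (κ * c⁻¹)) ^ 2 * (10 * c⁻¹) ^ 2 * (10 ^ 4) ^ 2 ≤
      q ^ 2 * q ^ 2 * q ^ 2 * q ^ 2 := by gcongr
  have h2 : (10 * r) ^ 2 * (10 * (κ * c⁻¹)) ^ 2 * (10 * c⁻¹) ^ 2 * (10 ^ 4) ^ 2 * c ^ 4 =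
      10 ^ 14 * r ^ 2 * κ ^ 2 := by
    field_simp
  have h3 : 10 ^ 14 * r ^ 2 * κ ^ 2 ≤ q ^ 8 * c ^ 4 := by
    rw [← h2]
    calc _ ≤ q ^ 2 * q ^ 2 * q ^ 2 * q ^ 2 * c ^ 4 := by gcongr
      _ = _ := by ring
  calc 6400 * γ ^ 2 * r ^ 2 * κ ^ 2 * (10 ^ 5 * L)
      ≤ 10 ^ 16 * γ ^ 2 * r ^ 2 * κ ^ 2 * L ^ 2 := by
        have h4 : 0 ≤ γ ^ 2 * r ^ 2 * κ ^ 2 := by positivity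
        have h5 : 6400 * (10 ^ 5 * L) ≤ 10 ^ 16 * L ^ 2 := by nlinarith
        linarith [mul_le_mul_of_nonneg_left h5 h4]
    _ = 100 * L ^ 2 * γ ^ 2 * (10 ^ 14 * r ^ 2 * κ ^ 2) := by ring
    _ ≤ 100 * L ^ 2 * γ ^ 2 * (q ^ 8 * c ^ 4) := by gcongr
    _ = 100 * L ^ 2 * q ^ 8 * γ ^ 2 * c ^ 4 := by ring
    _ ≤ p * c ^ 4 := by gcongr

/-- The bound for the failure probability of one update. -/
theorem failure_bound_le {n r : ℕ} {c κ μ' L p γ : ℝ} (hn : 0 < n) (hr : 0 < r) (hrn : r ≤ n)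
    (hc : 0 < c) (hc1 : c ≤ 1) (hκ : 1 ≤ κ) (hμ' : 1024 ≤ μ') (hL : 1 ≤ L) (hnL : n ≤ Real.exp L)
    (hγ : γ = μ' * r / n)
    (hp : L ^ 2 / (n : ℝ) ^ 2 * (10 * r * μ' / c * κ) ^ 10 ≤ p) :
    n * ((r ^ 2 : ℕ) : ℝ) ^ 2 * (2 * Real.exp (-(p / (16 * ((r ^ 2 : ℕ) : ℝ) ^ 2 * γ ^ 2)))) +
        n * Real.exp (-(p * n ^ 2 / 4)) +
        (p * c ^ 4 / (6400 * γ ^ 2 * r ^ 2 * κ ^ 2))⁻¹ ≤ 1 / (3 * 10 ^ 4 * L) := by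
  have hw : 1 ≤ c⁻¹ := (one_le_inv₀ hc).2 hc1
  have hn' : (1 : ℝ) ≤ n := by exact_mod_cast hn
  have hr' : (1 : ℝ) ≤ r := by exact_mod_cast hr
  have hrn' : (r : ℝ) ≤ n := by exact_mod_cast hrn
  set q := 10 * r * μ' / c * κ with hq
  have hq' : q = 10 * r * μ' * c⁻¹ * κ := by rw [hq, div_eq_mul_inv]
  have hμ1 : 1 ≤ μ' := by linarith
  have hcκ : 1 ≤ c⁻¹ * κ := one_le_mul_of_one_le_of_one_le hw hκ
  have hrμ : 1 ≤ r * μ' := one_le_mul_of_one_le_of_one_le hr' hμ1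
  have hq1 : 10 * (r * μ') ≤ q := by rw [hq']; nlinarith
  have hq2 : 10 * r ≤ q := by nlinarith
  have hq3 : 10 * (κ * c⁻¹) ≤ q := by rw [hq']; nlinarith
  have hq4 : 10 * c⁻¹ ≤ q := by nlinarith
  have hq5 : 10 ^ 4 ≤ q := by nlinarith
  have hq0 : 0 < q := by linarith
  have hpn : L ^ 2 * q ^ 10 ≤ p * n ^ 2 := by
    rw [div_mul_eq_mul_div, div_le_iff₀ (by positivity)] at hp
    exact hp
  have hp0 : 0 < p := lt_of_lt_of_le (by positivity) hp
  have hγ0 : 0 < γ := by rw [hγ]; positivity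
  -- Two of the ten factors q pay for γ = μ'r/n, by q ≥ 10rμ'; eight remain.
  have hpγ : 100 * L ^ 2 * q ^ 8 * γ ^ 2 ≤ p := by
    rw [hγ, div_pow, ← mul_div_assoc, div_le_iff₀ (by positivity)]
    refine le_trans ?_ hpn
    have h1 : (10 * (r * μ')) ^ 2 ≤ q ^ 2 := by gcongr
    calc 100 * L ^ 2 * q ^ 8 * (μ' * r) ^ 2 = L ^ 2 * q ^ 8 * (10 * (r * μ')) ^ 2 := by ring
      _ ≤ L ^ 2 * q ^ 8 * q ^ 2 := by gcongr
      _ = _ := by ring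
  have hLL : L ≤ L ^ 2 := by nlinarith
  have hE1 : 10 ^ 4 * L ≤ p / (16 * ((r ^ 2 : ℕ) : ℝ) ^ 2 * γ ^ 2) := by
    rw [le_div_iff₀ (by positivity)]
    refine le_trans ?_ hpγ
    push_cast
    have h1 : (10 * (r : ℝ)) ^ 4 ≤ q ^ 4 := by gcongr
    have h2 : (10 : ℝ) ^ 4 ≤ q ^ 4 := pow_le_pow_left₀ (by norm_num) (by linarith) 4
    calc 10 ^ 4 * L * (16 * ((r : ℝ) ^ 2) ^ 2 * γ ^ 2) = 16 * (10 * (r : ℝ)) ^ 4 * L * γ ^ 2 := by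
          ring
      _ ≤ 16 * q ^ 4 * L ^ 2 * γ ^ 2 := by gcongr
      _ = 16 * L ^ 2 * q ^ 4 * 1 * γ ^ 2 := by ring
      _ ≤ 100 * L ^ 2 * q ^ 4 * q ^ 4 * γ ^ 2 := by gcongr <;> linarith
      _ = _ := by ring
  have hE2 : 10 ^ 4 * L ≤ p * n ^ 2 / 4 := by
    have h2 : (10 : ℝ) ^ 10 ≤ q ^ 10 := pow_le_pow_left₀ (by norm_num) (by linarith) 10
    have : L ^ 2 * 10 ^ 10 ≤ L ^ 2 * q ^ 10 := by gcongr
    nlinarith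
  have hE3 := noise_term_le hc (one_pos.trans_le hr') (one_pos.trans_le hκ) hL hγ0 hp0 hq2 hq3 hq4
    hq5 hpγ
  have hexp : (n : ℝ) ^ 5 ≤ Real.exp (5 * L) := by
    calc (n : ℝ) ^ 5 ≤ Real.exp L ^ 5 := by gcongr
      _ = _ := by rw [← Real.exp_nat_mul]; norm_num
  have h1 : n * ((r ^ 2 : ℕ) : ℝ) ^ 2 *
      (2 * Real.exp (-(p / (16 * ((r ^ 2 : ℕ) : ℝ) ^ 2 * γ ^ 2)))) ≤
      2 * (Real.exp (5 * L) * Real.exp (-(10 ^ 4 * L))) := by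
    have h2 : n * ((r ^ 2 : ℕ) : ℝ) ^ 2 ≤ Real.exp (5 * L) := by
      refine le_trans ?_ hexp
      push_cast
      calc n * ((r : ℝ) ^ 2) ^ 2 ≤ n * ((n : ℝ) ^ 2) ^ 2 := by gcongr
        _ = _ := by ring
    calc _ ≤ Real.exp (5 * L) * (2 * Real.exp (-(10 ^ 4 * L))) := by gcongr
      _ = _ := by ring
  have h2 : n * Real.exp (-(p * n ^ 2 / 4)) ≤
      Real.exp (5 * L) * Real.exp (-(10 ^ 4 * L)) := by
    have h3 : (n : ℝ) ≤ Real.exp (5 * L) := hnL.trans (Real.exp_le_exp.2 (by linarith))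
    gcongr
  have h3 := exp_neg_le_inv hL
  have h4 : 1 / (10 ^ 5 * L) + 1 / (10 ^ 5 * L) ≤ 1 / (3 * 10 ^ 4 * L) := by
    rw [← add_div, div_le_div_iff₀ (by positivity) (by positivity)]
    linarith
  linarith

end Numerics

/-- Unit vectors whose matrix has smallest singular value at least `c`, with a `μ`-incoherent
span. -/
structure IsFactor {n r : ℕ} (c μ : ℝ) (x : Fin r → EuclideanSpace ℝ (Fin n)) : Prop where
  norm_eq_one : ∀ i, ‖x i‖ = 1
  lower : ∀ d : EuclideanSpace ℝ (Fin r), c * ‖d‖ ≤ ‖∑ i, d i • x i‖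
  incoherent : IsIncoherent μ (Submodule.span ℝ (Set.range x))

/-! ### Failure probability of one mode update -/

section Factor

variable {n r : ℕ} {c μ : ℝ} {x y z : Fin r → EuclideanSpace ℝ (Fin n)}

theorem IsFactor.finrank_span (h : IsFactor c μ x) (hc : 0 < c) :
    Module.finrank ℝ (Submodule.span ℝ (Set.range x)) = r := by
  rw [finrank_span_eq_card (linearIndependent_of_lower_bound hc h.lower), Fintype.card_fin]

theorem IsFactor.abs_apply_le (h : IsFactor c μ x) (hc : 0 < c) (i : Fin r) (j : Fin n) :
    |x i j| ≤ √(μ * r / n) := by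
  have := h.incoherent.abs_apply_le (h.finrank_span hc)
    (Submodule.subset_span (Set.mem_range_self i)) j
  rwa [h.norm_eq_one, mul_one] at this

theorem IsFactor.le_one (h : IsFactor c μ x) (hr : 0 < r) : c ≤ 1 := by
  have := h.lower (EuclideanSpace.single ⟨0, hr⟩ 1)
  simpa [PiLp.single_apply, h.norm_eq_one] using this

theorem IsFactor.one_le (h : IsFactor c μ x) (hc : 0 < c) (hr : 0 < r) : 1 ≤ μ :=
  h.incoherent.one_le (h.finrank_span hc) hr

theorem update_incoherence_le {κ μ' : ℝ} (hc : 0 < c) (hc1 : c ≤ 1)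
    (hμ : 1 ≤ μ) (hr : 0 < r) (hn : 0 < n) (hκ : 1 ≤ κ)
    (hμ' : μ' = (2 * μ * r / c ^ 2 * κ ^ 2) ^ 10) :
    8 * n * r * κ * √(μ * r / n) ^ 3 / c ^ 2 ≤ √(μ' * r / n) := by
  have hn' : (1 : ℝ) ≤ n := by exact_mod_cast hn
  have hr' : (1 : ℝ) ≤ r := by exact_mod_cast hr
  apply Real.le_sqrt_of_sq_le
  have h0 : 0 ≤ μ * r / n := by positivity
  have h1 : √(μ * r / n) ^ 2 = μ * r / n := Real.sq_sqrt h0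
  have h2 : (8 * n * r * κ * √(μ * r / n) ^ 3 / c ^ 2) ^ 2 =
      (64 * r ^ 4 * μ ^ 3 * κ ^ 2 / c ^ 4) * r / n := by
    calc _ = 64 * n ^ 2 * r ^ 2 * κ ^ 2 * (√(μ * r / n) ^ 2) ^ 3 / c ^ 4 := by
          field_simp
          ring
      _ = _ := by
          rw [h1]
          field_simp
  rw [h2, hμ']
  have := incoherence_constant_le hc hc1 hμ hr' hκ
  gcongr

/-- With high probability over the sample, every possible update of a mode improves the angle
and is incoherent. -/
theorem measureReal_bad_mode_le {T : Entry n → ℝ} {entry : Fin n → Fin n × Fin n → Entry n}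
    {V W : Submodule ℝ (EuclideanSpace ℝ (Fin n))} {σ : Fin r → ℝ}
    {α s₁ s μ' L : ℝ} {p : unitInterval} (hr : 0 < r)
    (hentry : ∀ j, (entry j).Injective)
    (hT : ∀ j q, T (entry j q) = unfoldRow σ x y z j q)
    (hα0 : 0 ≤ α) (hα : α ≤ 1 / 10) (hc : 0 < c) (hs : 0 < s) (hσs : ∀ i, s ≤ σ i)
    (hσs₁ : ∀ i, σ i ≤ s₁)
    (hV : sinAngle (Submodule.span ℝ (Set.range y)) V ≤ α)
    (hW : sinAngle (Submodule.span ℝ (Set.range z)) W ≤ α)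
    (hVr : Module.finrank ℝ V = r) (hWr : Module.finrank ℝ W = r)
    (hVμ : IsIncoherent μ' V) (hWμ : IsIncoherent μ' W)
    (hx : IsFactor c μ x) (hy : IsFactor c μ y) (hz : IsFactor c μ z)
    (hμ' : μ' = (2 * μ * r / c ^ 2 * (s₁ / s) ^ 2) ^ 10)
    (hL : 1 ≤ L) (hnL : n ≤ Real.exp L)
    (hp : L ^ 2 / (n : ℝ) ^ 2 * (10 * r * μ' / c * (s₁ / s)) ^ 10 ≤ (p : ℝ)) :
    (setBernoulli (Set.univ : Set (Entry n)) p).real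
      {S | ¬ ∀ V', IsModeUpdate r T S entry V W V' →
        sinAngle (Submodule.span ℝ (Set.range x)) V' ≤ 0.2 * α ∧ IsIncoherent μ' V'} ≤
      1 / (3 * 10 ^ 4 * L) := by
  -- If V ⊗ W has no orthonormal basis of r² vectors, there is no update and nothing to prove; if it
  -- has one, this gives its dimension.
  by_cases hB : ∃ B : Matrix (Fin (r ^ 2)) (Fin n × Fin n) ℝ, IsTensorBasis V W B
  swap
  · have : {S | ¬ ∀ V', IsModeUpdate r T S entry V W V' →
        sinAngle (Submodule.span ℝ (Set.range x)) V' ≤ 0.2 * α ∧ IsIncoherent μ' V'} = ∅ := by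
      rw [Set.eq_empty_iff_forall_notMem]
      intro S hS
      refine hS fun V' hV' => ?_
      obtain ⟨B, _, h, _⟩ := hV'
      exact absurd ⟨B, h⟩ hB
    rw [this, measureReal_empty]
    positivity
  obtain ⟨B, hBo, hBK⟩ := hB
  set K := tensorSpace V W with hK
  have hKr : Module.finrank ℝ K = r ^ 2 := by
    rw [← hBK, finrank_span_eq_card hBo.linearIndependent, Fintype.card_fin]
  have hrn : r ≤ n := by
    rw [← hVr]
    simpa using Submodule.finrank_le V
  have hn : 0 < n := hr.trans_le hrn
  have hn' : (0 : ℝ) < n := by exact_mod_cast hn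
  have hr' : (1 : ℝ) ≤ r := by exact_mod_cast hr
  have hc1 := hx.le_one hr
  have hμ := hx.one_le hc hr
  have hs₁ : s ≤ s₁ := (hσs ⟨0, hr⟩).trans (hσs₁ ⟨0, hr⟩)
  have hs₁0 : 0 < s₁ := hs.trans_le hs₁
  have hκ : 1 ≤ s₁ / s := (one_le_div hs).2 hs₁
  have hμ'1 : 1024 ≤ μ' := hμ' ▸ two_pow_ten_le_incoherence hc hc1 hμ hr' hκ
  have hp0 : 0 < (p : ℝ) := lt_of_lt_of_le (by positivity) hp
  set γ := √(μ' * r / n) ^ 2 with hγ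
  have hγ' : γ = μ' * r / n := Real.sq_sqrt (by positivity)
  have hγ0 : 0 < γ := by rw [hγ']; positivity
  have hD : ∑ j, ‖unfoldRow σ x y z j - K.starProjection (unfoldRow σ x y z j)‖ ^ 2 ≤
      (2 * α) ^ 2 * (r * s₁) ^ 2 := by
    refine le_trans ?_ (mul_le_mul_of_nonneg_left
      (sum_norm_unfoldRow_sq_le (fun i => hs.le.trans (hσs i)) hσs₁ hx.norm_eq_one hy.norm_eq_one
        hz.norm_eq_one) (sq_nonneg (2 * α)))
    rw [Finset.mul_sum]
    refine Finset.sum_le_sum fun j _ => ?_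
    rw [← mul_pow]
    have := norm_sub_starProjection_tensorSpace_le hV hW fun i => σ i * x i j
    exact pow_le_pow_left₀ (norm_nonneg _) this 2
  -- The value of C turns the condition on the noise level into an equality. Both sides are
  -- proportional to α², so C does not depend on α and the failure probability does not grow as the
  -- angle shrinks.
  have h1 := measureReal_not_goodSample_le (stdOrthonormalBasis ℝ K) p hγ0
    (fun q => norm_starProjection_tensorSpace_single_le hVμ hWμ hVr hWr q) hentry hD
    (C := p * c ^ 4 / (6400 * γ ^ 2 * r ^ 2 * (s₁ / s) ^ 2)) (η := c ^ 2 * s * α / 20)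
    (by positivity) (le_of_eq (by field_simp; ring))
  rw [Fintype.card_fin, hKr] at h1
  refine le_trans (le_trans (measureReal_mono fun S hS => ?_) h1)
    (failure_bound_le hn hr hrn hc hc1 hκ hμ'1 hL hnL hγ' hp)
  intro hgood
  refine hS fun V' hV' => ?_
  refine hV'.sinAngle_le_and_isIncoherent hr hT hα0 hα hc hs hσs hσs₁ hV hW hx.lower hy.lower
    hz.norm_eq_one (hx.abs_apply_le hc) (hy.abs_apply_le hc) (hz.abs_apply_le hc) ?_ hp0 hgood
  refine le_trans (le_of_eq ?_) (update_incoherence_le hc hc1 hμ hr hn hκ hμ')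
  field_simp

end Factor

/-! ### One iteration of all three modes -/

section Iteration

variable {n r k : ℕ} {c μ : ℝ} {x y z : Fin r → EuclideanSpace ℝ (Fin n)}

theorem IsModeUpdate.finrank_eq {T : Entry n → ℝ} {S : Set (Entry n)}
    {entry : Fin n → Fin n × Fin n → Entry n}
    {V W V' : Submodule ℝ (EuclideanSpace ℝ (Fin n))} (h : IsModeUpdate r T S entry V W V') :
    Module.finrank ℝ V' = r := by
  obtain ⟨B, H, -, -, h⟩ := h
  exact finrank_of_isTopLeftSingularSpace h

theorem IsIteration.hasDim {T : Entry n → ℝ} {S : Set (Entry n)} {W W' : SubspaceTriple n}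
    (h : IsIteration r T S W W') : W'.HasDim r :=
  ⟨h.1.finrank_eq, h.2.1.finrank_eq, h.2.2.finrank_eq⟩

theorem IsRun.hasDim {T : Entry n → ℝ} {W₀ : SubspaceTriple n}
    {W : (Fin k → Set (Entry n)) → ℕ → SubspaceTriple n} (hW : IsRun r k T W₀ W)
    (hW₀ : W₀.HasDim r) (ω : Fin k → Set (Entry n)) {t : ℕ} (ht : t ≤ k) : (W ω t).HasDim r := by
  cases t with
  | zero => rw [hW.init]; exact hW₀
  | succ m => exact (hW.iteration ω ⟨m, ht⟩).hasDim

/-- The outcome of an iteration that starts from `W` is good: the angles shrink, and the estimates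
are incoherent. -/
def IsGoodStep (x y z : Fin r → EuclideanSpace ℝ (Fin n)) (μ' : ℝ) (W W' : SubspaceTriple n) :
    Prop :=
  maxSinAngle (factorSpaces x y z) W' ≤ 0.2 * maxSinAngle (factorSpaces x y z) W ∧
    W'.Incoherent μ'

/-- A union bound over the modes, which therefore may share one sample. The old estimate is fixed
and all possible outcomes are covered simultaneously. -/
theorem measureReal_bad_iteration_le {W : SubspaceTriple n} {σ : Fin r → ℝ}
    {s₁ s μ' L : ℝ} {p : unitInterval} (hr : 0 < r) (hc : 0 < c) (hs : 0 < s)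
    (hσs : ∀ i, s ≤ σ i) (hσs₁ : ∀ i, σ i ≤ s₁)
    (hWr : W.HasDim r) (hWμ : W.Incoherent μ')
    (hWα : maxSinAngle (factorSpaces x y z) W ≤ 0.1)
    (hx : IsFactor c μ x) (hy : IsFactor c μ y) (hz : IsFactor c μ z)
    (hμ' : μ' = (2 * μ * r / c ^ 2 * (s₁ / s) ^ 2) ^ 10)
    (hL : 1 ≤ L) (hnL : n ≤ Real.exp L)
    (hp : L ^ 2 / (n : ℝ) ^ 2 * (10 * r * μ' / c * (s₁ / s)) ^ 10 ≤ (p : ℝ)) :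
    (setBernoulli (Set.univ : Set (Entry n)) p).real
      {S | ¬ ∀ W', IsIteration r (cpTensor σ x y z) S W W' → IsGoodStep x y z μ' W W'} ≤
      1 / (10 ^ 4 * L) := by
  set α := maxSinAngle (factorSpaces x y z) W with hαdef
  have hαx : sinAngle (Submodule.span ℝ (Set.range x)) W.x ≤ α :=
    (le_max_left _ _).trans (le_max_left _ _)
  have hαy : sinAngle (Submodule.span ℝ (Set.range y)) W.y ≤ α :=
    (le_max_right _ _).trans (le_max_left _ _)
  have hαz : sinAngle (Submodule.span ℝ (Set.range z)) W.z ≤ α := le_max_right _ _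
  have hα0 : 0 ≤ α := (sinAngle_nonneg _ _).trans hαx
  have hα : α ≤ 1 / 10 := by norm_num at hWα ⊢; exact hWα
  have h1 := measureReal_bad_mode_le (T := cpTensor σ x y z)
    (entry := fun j q => (j, q.1, q.2)) hr
    (fun j q q' h => by simpa [Prod.ext_iff] using h)
    (fun j q => by rw [unfoldRow_apply]; rfl)
    hα0 hα hc hs hσs hσs₁ hαy hαz hWr.2.1 hWr.2.2 hWμ.2.1 hWμ.2.2 hx hy hz hμ' hL hnL hp
  have h2 := measureReal_bad_mode_le (T := cpTensor σ x y z)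
    (entry := fun j q => (q.1, j, q.2)) hr
    (fun j q q' h => by simpa [Prod.ext_iff] using h)
    (fun j q => by
      rw [unfoldRow_apply]
      exact Finset.sum_congr rfl fun i _ => by ring)
    hα0 hα hc hs hσs hσs₁ hαx hαz hWr.1 hWr.2.2 hWμ.1 hWμ.2.2 hy hx hz hμ' hL hnL hp
  have h3 := measureReal_bad_mode_le (T := cpTensor σ x y z)
    (entry := fun j q => (q.1, q.2, j)) hr
    (fun j q q' h => by simpa [Prod.ext_iff] using h)
    (fun j q => by
      rw [unfoldRow_apply]
      exact Finset.sum_congr rfl fun i _ => by ring)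
    hα0 hα hc hs hσs hσs₁ hαx hαy hWr.1 hWr.2.1 hWμ.1 hWμ.2.1 hz hx hy hμ' hL hnL hp
  have hsum : 1 / (10 ^ 4 * L) =
      1 / (3 * 10 ^ 4 * L) + 1 / (3 * 10 ^ 4 * L) + 1 / (3 * 10 ^ 4 * L) := by
    field_simp
    norm_num
  rw [hsum]
  refine le_trans (measureReal_mono ?_) ((measureReal_union_le _ _).trans (add_le_add
    ((measureReal_union_le _ _).trans (add_le_add h1 h2)) h3))
  intro S hS
  by_contra hcon
  simp only [Set.mem_union, not_or, Set.mem_ofPred_eq, not_not] at hcon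
  obtain ⟨⟨g1, g2⟩, g3⟩ := hcon
  refine hS fun W' hW' => ?_
  obtain ⟨a1, b1⟩ := g1 _ hW'.1
  obtain ⟨a2, b2⟩ := g2 _ hW'.2.1
  obtain ⟨a3, b3⟩ := g3 _ hW'.2.2
  exact ⟨max_le (max_le a1 a2) a3, b1, b2, b3⟩

end Iteration

/-! ### Conditioning on the past -/

section Conditioning

/-- If, given the other coordinates, the coordinate `t` is bad with probability at most `δ`, then
the same holds conditionally on an event that does not depend on this coordinate. -/
theorem one_sub_le_cond_real {ι X : Type*} [Fintype ι] [Finite X] [MeasurableSpace X]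
    [MeasurableSingletonClass X] (ν : Measure X) [IsProbabilityMeasure ν] [DecidableEq ι] (t : ι)
    {A G : Set (ι → X)} {B : (ι → X) → Set X} {δ : ℝ}
    (hA : ∀ ω S, Function.update ω t S ∈ A ↔ ω ∈ A) (hB : ∀ ω S, B (Function.update ω t S) = B ω)
    (hBδ : ∀ ω ∈ A, ν.real (B ω) ≤ δ) (hG : ∀ ω ∈ A, ω t ∉ B ω → ω ∈ G)
    (hA0 : Measure.pi (fun _ => ν) A ≠ 0) :
    1 - δ ≤ (cond (Measure.pi fun _ => ν) A).real G := by
  set P : Measure (ι → X) := Measure.pi fun _ => ν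
  have hmeas : ∀ s : Set (ι → X), MeasurableSet s := fun s => s.toFinite.measurableSet
  have : IsProbabilityMeasure (cond P A) := cond_isProbabilityMeasure hA0
  have key : P (A ∩ {ω | ω t ∈ B ω}) ≤ ENNReal.ofReal δ * P A := by
    rw [← lintegral_indicator_one (hmeas _), ← lintegral_indicator_one (hmeas A),
      ← lintegral_const_mul _ (measurable_one.indicator (hmeas A))]
    -- Tonelli: integrate over coordinate t first. With the other coordinates fixed, membership in A
    -- and the bad set B are constant.
    refine lintegral_le_of_lmarginal_le {t} (measurable_one.indicator (hmeas _))
      ((measurable_one.indicator (hmeas A)).const_mul _) fun ω => ?_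
    rw [lmarginal_singleton, lmarginal_singleton]
    by_cases hω : ω ∈ A
    · have h1 : ∀ S, (A ∩ {ω | ω t ∈ B ω}).indicator (1 : (ι → X) → ENNReal)
          (Function.update ω t S) = (B ω).indicator 1 S := by
        intro S
        by_cases hS : S ∈ B ω <;> simp [hA, hB, hω, hS]
      have h2 : ∀ S, A.indicator (1 : (ι → X) → ENNReal) (Function.update ω t S) = 1 := by
        intro S
        simp [hA, hω]
      simp only [h1, h2, mul_one, lintegral_const, measure_univ]
      rw [lintegral_indicator_one (B ω).toFinite.measurableSet, ← ofReal_measureReal]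
      exact ENNReal.ofReal_le_ofReal (hBδ ω hω)
    · have h1 : ∀ S, (A ∩ {ω | ω t ∈ B ω}).indicator (1 : (ι → X) → ENNReal)
          (Function.update ω t S) = 0 := by
        intro S
        simp [hA, hω]
      simp [h1]
  have hGc : (cond P A) Gᶜ ≤ ENNReal.ofReal δ := by
    rw [cond_apply (hmeas A), mul_comm, ← div_eq_mul_inv]
    have hsub : A ∩ Gᶜ ⊆ A ∩ {ω | ω t ∈ B ω} := by
      rintro ω ⟨h1, h2⟩
      refine ⟨h1, ?_⟩
      by_contra h
      exact h2 (hG ω h1 h)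
    exact ENNReal.div_le_of_le_mul ((measure_mono hsub).trans key)
  have hAne : A.Nonempty := by
    by_contra h
    rw [Set.not_nonempty_iff_eq_empty] at h
    simp [h] at hA0
  obtain ⟨ω₀, hω₀⟩ := hAne
  have hδ : 0 ≤ δ := measureReal_nonneg.trans (hBδ ω₀ hω₀)
  have h1 := probReal_compl_eq_one_sub (μ := cond P A) (hmeas G)
  have h2 : (cond P A).real Gᶜ ≤ δ := ENNReal.toReal_le_of_le_ofReal hδ hGc
  linarith

end Conditioning

/-! ### The case n = r = 1 -/

section Degenerate

/-- The only line in ℝ¹ is the whole space, so the sines vanish, and the incoherence threshold is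
√μ' ≥ 1. -/
theorem isGoodStep_of_dim_one {r : ℕ} (x y z : Fin r → EuclideanSpace ℝ (Fin 1)) {μ' : ℝ}
    (hμ' : 1 ≤ μ') (W : SubspaceTriple 1) {W' : SubspaceTriple 1} (hW' : W'.HasDim 1) :
    IsGoodStep x y z μ' W W' := by
  have htop : ∀ V : Submodule ℝ (EuclideanSpace ℝ (Fin 1)), Module.finrank ℝ V = 1 → V = ⊤ :=
    fun V hV => Submodule.eq_top_of_finrank_eq (by simpa using hV)
  have hsin : ∀ U V : Submodule ℝ (EuclideanSpace ℝ (Fin 1)), Module.finrank ℝ V = 1 →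
      sinAngle U V ≤ 0 := by
    intro U V hV
    refine sinAngle_le le_rfl fun v _ => ?_
    rw [htop V hV]
    simp
  have hinc : ∀ V : Submodule ℝ (EuclideanSpace ℝ (Fin 1)), Module.finrank ℝ V = 1 →
      IsIncoherent μ' V := by
    intro V hV i
    refine (Submodule.norm_orthogonalProjectionOnto_apply_le V _).trans ?_
    rw [hV]
    simpa using hμ'
  have h0 : 0 ≤ maxSinAngle (factorSpaces x y z) W := (sinAngle_nonneg _ _).trans (le_max_right _ _)
  exact ⟨(max_le (max_le (hsin _ _ hW'.1) (hsin _ _ hW'.2.1)) (hsin _ _ hW'.2.2)).trans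
    (by positivity), hinc _ hW'.1, hinc _ hW'.2.1, hinc _ hW'.2.2⟩

end Degenerate

end KroneckerCompletion

/-! ### The main theorem -/

theorem theorem4p2 {n r k : ℕ} (hr : 0 < r)
    -- the tensor
    (σ : Fin r → ℝ) (hσ_anti : Antitone σ) (hσ_pos : ∀ i, 0 < σ i)
    (x y z : Fin r → EuclideanSpace ℝ (Fin n))
    (hx : ∀ i, ‖x i‖ = 1) (hy : ∀ i, ‖y i‖ = 1) (hz : ∀ i, ‖z i‖ = 1)
    -- robust linear independence and incoherence of the factors
    (c : ℝ) (hc : 0 < c)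
    (hcx : c ≤ KroneckerCompletion.smallestSingularValue x)
    (hcy : c ≤ KroneckerCompletion.smallestSingularValue y)
    (hcz : c ≤ KroneckerCompletion.smallestSingularValue z)
    (μ : ℝ) (hμ : (KroneckerCompletion.factorSpaces x y z).Incoherent μ)
    -- abbreviations
    (σ₁ σᵣ μ' L : ℝ) (hσ₁ : σ₁ = σ ⟨0, hr⟩) (hσᵣ : σᵣ = σ ⟨r - 1, Nat.sub_lt hr one_pos⟩)
    (hμ' : μ' = (2 * μ * r / c ^ 2 * (σ₁ ^ 2 / σᵣ ^ 2)) ^ 10)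
    (hL : L = Real.log ((n * σ₁) / (c * σᵣ)))
    -- the sampling probability of each iteration
    (p' : unitInterval)
    (hp' : L ^ 2 / (n : ℝ) ^ 2 * (10 * r * μ' / c * (σ₁ / σᵣ)) ^ 10 ≤ (p' : ℝ))
    -- a run of the algorithm
    (W₀ : KroneckerCompletion.SubspaceTriple n) (hW₀ : W₀.HasDim r)
    (W : (Fin k → Set (KroneckerCompletion.Entry n)) → ℕ →
      KroneckerCompletion.SubspaceTriple n)
    (hW : KroneckerCompletion.IsRun r k (KroneckerCompletion.cpTensor σ x y z) W₀ W)
    -- a time step, and an event of the past on which the current estimate is good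
    (t : Fin k) (A : Set (Fin k → Set (KroneckerCompletion.Entry n)))
    (hA : KroneckerCompletion.DependsOnFirst (t : ℕ) A)
    (hA_pos : KroneckerCompletion.sampleLaw n k p' A ≠ 0)
    (hA_incoherent : ∀ ω ∈ A, (W ω t).Incoherent μ')
    (hA_angle : ∀ ω ∈ A,
      KroneckerCompletion.maxSinAngle (KroneckerCompletion.factorSpaces x y z) (W ω t) ≤ 0.1) :
    1 - 1 / (10 ^ 4 * L) ≤
      (ProbabilityTheory.cond (KroneckerCompletion.sampleLaw n k p') A).real
        {ω | KroneckerCompletion.maxSinAngle (KroneckerCompletion.factorSpaces x y z)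
              (W ω (t + 1)) ≤
            0.2 * KroneckerCompletion.maxSinAngle (KroneckerCompletion.factorSpaces x y z)
              (W ω t) ∧
          (W ω (t + 1)).Incoherent μ'} := by
  have hfx : KroneckerCompletion.IsFactor c μ x := ⟨hx, fun d =>
    (mul_le_mul_of_nonneg_right hcx (norm_nonneg d)).trans
      (KroneckerCompletion.smallestSingularValue_mul_norm_le hr x d), hμ.1⟩
  have hfy : KroneckerCompletion.IsFactor c μ y := ⟨hy, fun d =>
    (mul_le_mul_of_nonneg_right hcy (norm_nonneg d)).trans
      (KroneckerCompletion.smallestSingularValue_mul_norm_le hr y d), hμ.2.1⟩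
  have hfz : KroneckerCompletion.IsFactor c μ z := ⟨hz, fun d =>
    (mul_le_mul_of_nonneg_right hcz (norm_nonneg d)).trans
      (KroneckerCompletion.smallestSingularValue_mul_norm_le hr z d), hμ.2.2⟩
  have hs : 0 < σᵣ := hσᵣ ▸ hσ_pos _
  have hσs : ∀ i, σᵣ ≤ σ i := fun i => hσᵣ ▸ hσ_anti (by rw [Fin.le_def]; simp; omega)
  have hσs₁ : ∀ i, σ i ≤ σ₁ := fun i => hσ₁ ▸ hσ_anti (by rw [Fin.le_def]; simp)
  have hs₁ : σᵣ ≤ σ₁ := (hσs ⟨0, hr⟩).trans (hσs₁ _)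
  have hs₁0 : 0 < σ₁ := hs.trans_le hs₁
  have hκ : 1 ≤ σ₁ / σᵣ := (one_le_div hs).2 hs₁
  have hc1 := hfx.le_one hr
  have hμ1 := hfx.one_le hc hr
  have hr' : (1 : ℝ) ≤ r := by exact_mod_cast hr
  have hrn : r ≤ n := by
    rw [← hW₀.1]
    simpa using Submodule.finrank_le W₀.x
  have hn' : (1 : ℝ) ≤ n := by exact_mod_cast hr.trans_le hrn
  rw [← div_pow] at hμ'
  have hμ'1 : 1024 ≤ μ' :=
    hμ' ▸ KroneckerCompletion.two_pow_ten_le_incoherence hc hc1 hμ1 hr' hκ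
  have hcκ : 1 ≤ c⁻¹ * (σ₁ / σᵣ) :=
    one_le_mul_of_one_le_of_one_le ((one_le_inv₀ hc).2 hc1) hκ
  have harg : (n * σ₁) / (c * σᵣ) = n * (c⁻¹ * (σ₁ / σᵣ)) := by field_simp
  have hnarg : (n : ℝ) ≤ (n * σ₁) / (c * σᵣ) := by
    rw [harg]
    exact le_mul_of_one_le_right (by positivity) hcκ
  have hargpos : 0 < (n * σ₁) / (c * σᵣ) := by positivity
  have hLn : Real.log n ≤ L := hL ▸ Real.log_le_log (by positivity) hnarg
  have hL0 : 0 ≤ L := (Real.log_nonneg hn').trans hLn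
  have hnL : n ≤ Real.exp L := by
    rw [hL, Real.exp_log hargpos]
    exact hnarg
  have hP : MeasureTheory.IsProbabilityMeasure (KroneckerCompletion.sampleLaw n k p') := by
    unfold KroneckerCompletion.sampleLaw
    infer_instance
  have hprob := ProbabilityTheory.cond_isProbabilityMeasure hA_pos
  -- For L = 0 the quotient 1/(10⁴L) is 0 by convention, so the claim is probability 1. It holds
  -- since n = r = 1.
  rcases hL0.eq_or_lt with hLz | hLpos
  · have hone : (n * σ₁) / (c * σᵣ) = 1 :=
      Real.eq_one_of_pos_of_log_eq_zero hargpos (by rw [← hL, ← hLz])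
    have hn1 : n = 1 := by
      have : (n : ℝ) ≤ 1 := hone ▸ hnarg
      have : n ≤ 1 := by exact_mod_cast this
      omega
    subst hn1
    obtain rfl : r = 1 := by omega
    have huniv : {ω | KroneckerCompletion.maxSinAngle (KroneckerCompletion.factorSpaces x y z)
          (W ω (t + 1)) ≤ 0.2 * KroneckerCompletion.maxSinAngle
            (KroneckerCompletion.factorSpaces x y z) (W ω t) ∧
          (W ω (t + 1)).Incoherent μ'} = Set.univ :=
      Set.eq_univ_of_forall fun ω => KroneckerCompletion.isGoodStep_of_dim_one x y z
        (by linarith) (W ω t) (hW.hasDim hW₀ ω t.2)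
    rw [huniv, MeasureTheory.probReal_univ, ← hLz]
    norm_num
  -- For 0 < L ≤ 10⁻⁴ the claimed lower bound is not positive.
  rcases le_or_gt L (1 / 10 ^ 4) with hLs | hLs
  · refine le_trans ?_ MeasureTheory.measureReal_nonneg
    rw [sub_nonpos, le_div_iff₀ (by positivity)]
    linarith
  -- Otherwise p' ≤ 1 forces n to be large: with q ≥ 10, n² ≥ L²q¹⁰ ≥ 10⁻⁸ · 10¹⁰ = 100, and then L
  -- ≥ log n ≥ 1.
  have hL1 : 1 ≤ L := by
    set q := 10 * r * μ' / c * (σ₁ / σᵣ) with hq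
    have hq10 : 10 ≤ q := by
      have h1 : q = 10 * (r * μ' * (c⁻¹ * (σ₁ / σᵣ))) := by rw [hq]; field_simp
      have h2 : 1 ≤ r * μ' * (c⁻¹ * (σ₁ / σᵣ)) :=
        one_le_mul_of_one_le_of_one_le (one_le_mul_of_one_le_of_one_le hr' (by linarith)) hcκ
      linarith
    have h1 := hp'.trans p'.2.2
    rw [div_mul_eq_mul_div, div_le_one (by positivity)] at h1
    have h2 : (10 : ℝ) ^ 10 ≤ q ^ 10 := pow_le_pow_left₀ (by norm_num) hq10 10
    have h3 : (1 / 10 ^ 4) ^ 2 ≤ L ^ 2 := pow_le_pow_left₀ (by norm_num) hLs.le 2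
    have h4 : (10 : ℝ) ^ 2 ≤ (n : ℝ) ^ 2 := by
      refine le_trans ?_ h1
      calc (10 : ℝ) ^ 2 = (1 / 10 ^ 4) ^ 2 * 10 ^ 10 := by norm_num
        _ ≤ L ^ 2 * q ^ 10 := by gcongr
    have h5 : (10 : ℝ) ≤ n := le_of_sq_le_sq h4 (by positivity)
    refine le_trans ?_ hLn
    rw [Real.le_log_iff_exp_le (by positivity)]
    linarith [Real.exp_one_lt_three]
  refine KroneckerCompletion.one_sub_le_cond_real
    (ProbabilityTheory.setBernoulli (Set.univ : Set (KroneckerCompletion.Entry n)) p') t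
    (B := fun ω => {S | ¬ ∀ W', KroneckerCompletion.IsIteration r
      (KroneckerCompletion.cpTensor σ x y z) S (W ω t) W' →
        KroneckerCompletion.IsGoodStep x y z μ' (W ω t) W'})
    (fun ω S => hA _ _ fun s hst => Function.update_of_ne (by rintro rfl; omega) _ _)
    (fun ω S => ?_) (fun ω hω => ?_) (fun ω hω hgood => ?_) hA_pos
  · have : W (Function.update ω t S) t = W ω t := hW.nonanticipating _ _ _ t.2.le fun s hst =>
      Function.update_of_ne (by rintro rfl; omega) _ _
    simp only [this]
  · exact KroneckerCompletion.measureReal_bad_iteration_le hr hc hs hσs hσs₁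
      (hW.hasDim hW₀ ω t.2.le) (hA_incoherent ω hω) (hA_angle ω hω) hfx hfy hfz hμ' hL1 hnL hp'
  · simp only [Set.mem_ofPred_eq, not_not] at hgood
    exact hgood _ (hW.iteration ω t)
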